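/- **Setting.** There are $n\ge 1$ tasks; task $i$ has an upper-level function $f_i$ and a lower-level function $g_i$, both $\mathbb R^p\times\mathbb R^q\to\mathbb R$ with $q\ge 1$. Put $\phi_i^*(\theta)=\operatorname{argmin}_{\phi\in\mathbb R^q} g_i(\theta,\phi)$ and $F(\theta)=\frac1n\sum_{i=1}^n f_i(\theta,\phi_i^*(\theta))$. Let $\mu>0$. Assume that every $g_i(\theta,\cdot)$ is $\mu$-strongly convex, that for every $i$ the functions $f_i$, $\nabla f_i$, $\nabla g_i$, $\nabla^2_{\theta\phi}g_i$, $\nabla^2_\phi g_i$ exist and are Lipschitz in $(\theta,\phi)$ with constants $l_{f,0},l_f,l_g,l_{g,1},l_{g,2}$ respectively (Euclidean norms, operator norms for matrices), and that $F$ is bounded below ($F$ need not be convex). Put $\kappa=l_g/\mu$. **Algorithm.** Given stepsizes $\lambda_\phi,\lambda_\theta>0$, integers $K,N$ and initial points $\theta_0$, $\phi_{i,0}$, put $\phi_{i,0}^0=\phi_{i,0}$, $v_{i,0}^0=0$. In outer iteration $t=0,1,2,\dots$, for every task $i$: (a) do $K$ steps $\phi_{i,t}^{k+1}=\phi_{i,t}^k-\lambda_\phi\nabla_\phi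 g_i(\theta_t,\phi_{i,t}^k)$; (b) starting from $v_{i,t}^0$, do $N$ conjugate-gradient steps for the system $\nabla^2_\phi g_i(\theta_t,\phi_{i,t}^K)\,v=\nabla_\phi f_i(\theta_t,\phi_{i,t}^K)$ (stopping if the residual vanishes) to get $v_{i,t}^N$. Then $$\theta_{t+1}=\theta_t-\lambda_\theta\,\frac1n\sum_{i=1}^n\Big(\nabla_\theta f_i(\theta_t,\phi_{i,t}^K)-\nabla^2_{\theta\phi}g_i(\theta_t,\phi_{i,t}^K)\,v_{i,t}^N\Big),$$ and the next iteration starts from $\phi_{i,t+1}^0=\phi_{i,t}^K$ and $v_{i,t+1}^0=v_{i,t}^N$. **Theorem.** There are universal constants $c_K,c_N,c_E>0$ such that the following holds. For all $\mu>0$, all Lipschitz constants as above and every $0<\lambda_\phi\le 1/l_g$ there are $\lambda_{\max}>0$ and $C>0$, depending only on these numbers, such that for all $p,q,n$, all tasks as above, all $0<\lambda_\theta\le\lambda_{\max}$ and all initial points, $F$ is differentiable and, with $$\Delta_0=1+F(\theta_0)-\inf F+\frac1n\sum_{i=1}^n\|\phi_{i,0}-\phi_i^*(\theta_0)\|^2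 :$$ 1. If $K\ge c_K\kappa$ and $N\ge c_N\sqrt\kappa$, then for all $T\ge1$ $$\frac1{T+1}\sum_{t=0}^{T}\|\nabla F(\theta_t)\|^2\le\frac{C\Delta_0}{\lambda_\theta}\cdot\frac1T ,$$ and $\nabla F(\theta_t)\to0$ as $t\to\infty$. 2. If $K=\lceil c_K\kappa\rceil$ and $N=\lceil c_N\sqrt\kappa\rceil$, then for every $\epsilon>0$ there is $T\ge1$ with $\frac1T\sum_{t=0}^{T-1}\|\nabla F(\theta_t)\|^2\le\epsilon$ such that the first $T$ outer iterations use at most $$c_E\,n\,\kappa\Big(1+\frac{C\Delta_0}{\lambda_\theta\,\epsilon}\Big)$$ gradient evaluations in $\phi$, and at most as many in $\theta$. Here each evaluation of $\nabla_\phi g_i$ or $\nabla_\phi f_i$ and each Hessian-vector product with $\nabla_\phi^2 g_i$ counts once in $\phi$, each evaluation of $\nabla_\theta f_i$ counts once in $\theta$, and each product with $\nabla^2_{\theta\phi}g_i$ counts once in both. -/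

import Mathlib

open scoped NNReal Topology

noncomputable section

namespace MetaLearning

/-- Euclidean space of dimension `d`. -/
abbrev Vec (d : ℕ) : Type := EuclideanSpace ℝ (Fin d)

/-- The space of pairs `(θ, φ)` with its Euclidean norm `√(‖θ‖² + ‖φ‖²)`. -/
abbrev Pair (p q : ℕ) : Type := WithLp 2 (Vec p × Vec q)

section Calculus

variable {p q : ℕ}

/-- A function of `θ` and `φ` as a function of the pair. -/
def joint {X : Type*} (h : Vec p → Vec q → X) : Pair p q → X := fun z => h z.fst z.snd

/-- Partial gradient with respect to `θ`. -/
def gradTheta (h : Vec p → Vec q → ℝ) (θ : Vec p) (φ : Vec q) : Vec p :=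
  gradient (fun θ' => h θ' φ) θ

/-- Partial gradient with respect to `φ`. -/
def gradPhi (h : Vec p → Vec q → ℝ) (θ : Vec p) (φ : Vec q) : Vec q :=
  gradient (fun φ' => h θ φ') φ

/-- The Hessian with respect to `φ`, as an operator. -/
def hessPhi (h : Vec p → Vec q → ℝ) (θ : Vec p) (φ : Vec q) : Vec q →L[ℝ] Vec q :=
  fderiv ℝ (fun φ' => gradPhi h θ φ') φ

/-- The `p × q` matrix of mixed derivatives `∂²h / ∂θ_a ∂φ_b`, as an operator. It is the transpose
of the derivative of the `φ`-gradient with respect to `θ`. -/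
def jacThetaPhi (h : Vec p → Vec q → ℝ) (θ : Vec p) (φ : Vec q) : Vec q →L[ℝ] Vec p :=
  ContinuousLinearMap.adjoint (fderiv ℝ (fun θ' => gradPhi h θ' φ) θ)

/-- The smoothness required of one task with upper-level function `f` and lower-level function `g`:
the derivatives that are spoken of exist, and `f`, `∇f`, `∇g`, `∇²_{θφ} g`, `∇²_φ g` are Lipschitz
functions of the pair `(θ, φ)` (operator norm for the last two). -/
structure TaskSmooth (lf0 lf lg lg1 lg2 : ℝ≥0) (f g : Vec p → Vec q → ℝ) : Prop where
  differentiable_f : Differentiable ℝ (joint f)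
  differentiable_g : Differentiable ℝ (joint g)
  differentiable_gradPhi_g : Differentiable ℝ (joint (gradPhi g))
  lipschitz_f : LipschitzWith lf0 (joint f)
  lipschitz_grad_f : LipschitzWith lf (gradient (joint f))
  lipschitz_grad_g : LipschitzWith lg (gradient (joint g))
  lipschitz_jac_g : LipschitzWith lg1 (joint (jacThetaPhi g))
  lipschitz_hess_g : LipschitzWith lg2 (joint (hessPhi g))

/-- The lower-level solution `φ*(θ) = argmin_φ g(θ, φ)`. -/
def phiStar (g : Vec p → Vec q → ℝ) (θ : Vec p) : Vec q :=
  Classical.epsilon fun φ => ∀ φ', g θ φ ≤ g θ φ'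

/-- The meta-objective `F(θ) = (1/n) ∑ᵢ fᵢ(θ, φᵢ*(θ))` over all `n` tasks. -/
def metaObjective {n : ℕ} (f g : Fin n → Vec p → Vec q → ℝ) (θ : Vec p) : ℝ :=
  (1 / (n : ℝ)) * ∑ i, f i θ (phiStar (g i) θ)

end Calculus

section Algorithm

variable {p q : ℕ}

/-- One gradient step on the lower-level problem; the second component counts the gradient
evaluations. -/
def innerStep (g : Vec p → Vec q → ℝ) (lamPhi : ℝ) (θ : Vec p) (s : Vec q × ℕ) : Vec q × ℕ :=
  (s.1 - lamPhi • gradPhi g θ s.1, s.2 + 1)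

/-- State of the conjugate-gradient subroutine: approximate solution `v`, residual `r`, search
direction `d`, and the number of evaluations spent. -/
structure CGState (q : ℕ) where
  v : Vec q
  r : Vec q
  d : Vec q
  evals : ℕ

/-- Start of the subroutine: one evaluation of `∇_φ f` and one Hessian-vector product. -/
def cgStart (f g : Vec p → Vec q → ℝ) (θ : Vec p) (φ v : Vec q) : CGState q :=
  let r := gradPhi f θ φ - hessPhi g θ φ v
  { v := v, r := r, d := r, evals := 2 }

/-- One conjugate-gradient step, which uses one Hessian-vector product. Once the residual is zero,
`0 / 0 = 0` makes the step leave `v` unchanged, that is, the subroutine has terminated. -/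
def cgStep (g : Vec p → Vec q → ℝ) (θ : Vec p) (φ : Vec q) (s : CGState q) : CGState q :=
  let h := hessPhi g θ φ s.d
  let η : ℝ := inner ℝ s.r s.r / inner ℝ s.d h
  let r' := s.r - η • h
  let ζ : ℝ := inner ℝ r' r' / inner ℝ s.r s.r
  { v := s.v + η • s.d, r := r', d := r' + ζ • s.d, evals := s.evals + 1 }

/-- What one task contributes to one outer iteration. -/
structure TaskOutput (p q : ℕ) where
  /-- the last lower-level iterate -/
  φ : Vec q
  /-- the approximate Hessian-inverse-vector product -/
  v : Vec q
  /-- the Jacobian-vector product -/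
  jv : Vec p
  /-- the upper-level partial gradient with respect to `θ` -/
  gradF : Vec p
  /-- evaluations with respect to `φ` -/
  evalsPhi : ℕ
  /-- evaluations with respect to `θ` -/
  evalsTheta : ℕ

/-- The work on one task in one outer iteration: `K` lower-level gradient steps from `φ`, then `N`
conjugate-gradient steps from `v` at the last lower-level iterate. Gradients and Hessian-vector
products with respect to `φ` count as one evaluation in `φ`, the gradient of `f` with respect to `θ`
as one evaluation in `θ`, and the Jacobian-vector product as one evaluation in each. -/
def runTask (f g : Vec p → Vec q → ℝ) (lamPhi : ℝ) (K N : ℕ) (θ : Vec p) (φ v : Vec q) :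
    TaskOutput p q :=
  let low := (innerStep g lamPhi θ)^[K] (φ, 0)
  let cg := (cgStep g θ low.1)^[N] (cgStart f g θ low.1 v)
  { φ := low.1
    v := cg.v
    jv := jacThetaPhi g θ low.1 cg.v
    gradF := gradTheta f θ low.1
    evalsPhi := low.2 + cg.evals + 1
    evalsTheta := 1 + 1 }

/-- State of the algorithm at the beginning of an outer iteration, with the total numbers of
evaluations so far. -/
structure MetaState (p q n : ℕ) where
  θ : Vec p
  φ : Fin n → Vec q
  v : Fin n → Vec q
  evalsPhi : ℕ
  evalsTheta : ℕ

variable {n : ℕ}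

/-- One outer iteration, over all tasks, with warm starts for `φ` and `v`. -/
def metaStep (f g : Fin n → Vec p → Vec q → ℝ) (lamPhi lamTheta : ℝ) (K N : ℕ)
    (s : MetaState p q n) : MetaState p q n :=
  let out := fun i => runTask (f i) (g i) lamPhi K N s.θ (s.φ i) (s.v i)
  let hypergrad : Vec p :=
    (1 / (n : ℝ)) • ∑ i, (out i).gradF - (1 / (n : ℝ)) • ∑ i, (out i).jv
  { θ := s.θ - lamTheta • hypergrad
    φ := fun i => (out i).φ
    v := fun i => (out i).v
    evalsPhi := s.evalsPhi + ∑ i, (out i).evalsPhi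
    evalsTheta := s.evalsTheta + ∑ i, (out i).evalsTheta }

/-- The state after `t` outer iterations, started at `θ0` and `φ0` with zero vectors `v`. -/
def metaRun (f g : Fin n → Vec p → Vec q → ℝ) (lamPhi lamTheta : ℝ) (K N : ℕ)
    (θ0 : Vec p) (φ0 : Fin n → Vec q) (t : ℕ) : MetaState p q n :=
  (metaStep f g lamPhi lamTheta K N)^[t]
    { θ := θ0, φ := φ0, v := fun _ => 0, evalsPhi := 0, evalsTheta := 0 }

/-- `1 + (F(θ₀) - inf F) + (1/n) ∑ᵢ ‖φᵢ,₀ - φᵢ*(θ₀)‖²`, the dependence of the rate on the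
starting point. -/
def initialGap (f g : Fin n → Vec p → Vec q → ℝ) (θ0 : Vec p) (φ0 : Fin n → Vec q) : ℝ :=
  1 + (metaObjective f g θ0 - ⨅ θ, metaObjective f g θ)
    + (1 / (n : ℝ)) * ∑ i, ‖φ0 i - phiStar (g i) θ0‖ ^ 2

end Algorithm

end MetaLearning

end

/-! The method is gradient descent on `F` with an inexact gradient. Differentiating the identity ∇_φ
g(θ, φ*(θ)) = 0 shows that ∇F is the mean over the tasks of ∇_θ f − ∇²_{θφ}g · v*, where v* solves
the Hessian system at φ*(θ) (`hasGradientAt_comp_phiStar`). Strong convexity makes φ*, v* and hence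
∇F Lipschitz in θ.

The warm starts keep φ and v close to φ* and v*. A gradient step contracts φ − φ*, and 4√κ
conjugate-gradient steps halve the Euclidean error of v. The system actually solved sits at the
current φ instead of φ*, so the error of v inherits a multiple of the error of φ. If the latter gets
a large enough weight, the weighted sum contracts by a factor r < 1, up to a multiple of the
movement of θ (`exists_trackingError_constants`). One gradient step suffices for this, because r,
and with it λ_max and C, may depend on λ_φ.

The tracking error bounds the gradient error, and the movement of θ is λ_θ times the inexact
gradient. For small λ_θ the potential F + a · (mean squared tracking error) therefore drops by λ_θ/2
· ‖∇F‖² per iteration (`exists_potential_decrease`). Telescoping bounds the sum of all ‖∇F(θ_t)‖² by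
CΔ₀/λ_θ, which gives the rate, the convergence and the evaluation count.

The order √κ without a logarithm requires a conjugate-gradient estimate that starts and ends in the
Euclidean norm. `energy_bound` bounds m² times the final energy by the initial Euclidean error;
returning to the Euclidean norm then costs only 1/μ. -/

noncomputable section

namespace MetaLearning

/-! ### Conjugate gradients: the energy decays like 1/m². -/

section ConjugateGradient

variable {E : Type*} [NormedAddCommGroup E] [InnerProductSpace ℝ E]

local notation "⟪" x ", " y "⟫" => inner ℝ x y

/-- The recurrences of the conjugate-gradient method for the operator `A`: iterates `x`, residuals
`r`, search directions `d`. -/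
structure IsCGRun (A : E →L[ℝ] E) (x r d : ℕ → E) : Prop where
  d_zero : d 0 = r 0
  x_succ : ∀ k, x (k + 1) = x k + (⟪r k, r k⟫ / ⟪d k, A (d k)⟫) • d k
  r_succ : ∀ k, r (k + 1) = r k - (⟪r k, r k⟫ / ⟪d k, A (d k)⟫) • A (d k)
  d_succ : ∀ k, d (k + 1) = r (k + 1) + (⟪r (k + 1), r (k + 1)⟫ / ⟪r k, r k⟫) • d k

namespace IsCGRun

variable {A : E →L[ℝ] E} {x r d : ℕ → E} {μ L : ℝ}

/-- After termination all steps vanish. With the convention 0 / 0 = 0 the estimates below need no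
separate treatment of termination. -/
theorem d_eq_zero (h : IsCGRun A x r d) {k : ℕ} (hk : r k = 0) : d k = 0 := by
  cases k with
  | zero => rw [h.d_zero, hk]
  | succ k => rw [h.d_succ, hk]; simp

/-- The three relations feed each other, so they are proved by one induction: residuals orthogonal
to earlier directions, directions conjugate with respect to `A`, and the value that makes the step
length an exact line search. -/
theorem orthogonality (h : IsCGRun A x r d) (hsymm : ∀ u w, ⟪A u, w⟫ = ⟪u, A w⟫)
    (hpos : ∀ u, u ≠ 0 → 0 < ⟪u, A u⟫) (k : ℕ) :
    (∀ j < k, ⟪r k, d j⟫ = 0) ∧ (∀ j < k, ⟪d k, A (d j)⟫ = 0) ∧ ⟪r k, d k⟫ = ⟪r k, r k⟫ := by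
  induction k with
  | zero => simp [h.d_zero]
  | succ k ih =>
    obtain ⟨ih1, ih2, ih3⟩ := ih
    have hd0 : d k = 0 → r k = 0 := fun h0 => by
      rw [h0, inner_zero_right] at ih3
      exact inner_self_eq_zero.1 ih3.symm
    have hrd : ∀ j < k + 1, ⟪r (k + 1), d j⟫ = 0 := by
      intro j hj
      rw [h.r_succ, inner_sub_left, inner_smul_left, hsymm]
      rcases Nat.lt_succ_iff_lt_or_eq.1 hj with hj | rfl
      · simp [ih1 j hj, ih2 j hj]
      · by_cases hz : d j = 0
        · simp [hz]
        · have := (hpos _ hz).ne'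
          simp only [conj_trivial]
          rw [ih3]
          field_simp
          ring
    have hrr : ∀ j < k + 1, ⟪r (k + 1), r j⟫ = 0 := by
      intro j hj
      cases j with
      | zero => rw [← h.d_zero]; exact hrd 0 hj
      | succ j =>
        have e : r (j + 1) = d (j + 1) - (⟪r (j + 1), r (j + 1)⟫ / ⟪r j, r j⟫) • d j := by
          rw [h.d_succ]; abel
        rw [e, inner_sub_right, inner_smul_right, hrd _ hj, hrd j (by omega)]
        simp
    refine ⟨hrd, ?_, ?_⟩
    · intro j hj
      by_cases hz : d j = 0
      · simp [hz]
      have hdA := (hpos _ hz).ne'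
      have hrj : r j ≠ 0 := fun h0 => hz (h.d_eq_zero h0)
      have hrj' : ⟪r j, r j⟫ ≠ 0 := inner_self_ne_zero.2 hrj
      -- `A (d j)` is a multiple of a difference of consecutive residuals, so conjugacy reduces to
      -- orthogonality of residuals.
      have e : A (d j) = (⟪d j, A (d j)⟫ / ⟪r j, r j⟫) • (r j - r (j + 1)) := by
        rw [h.r_succ j, sub_sub_cancel, smul_smul, div_mul_div_cancel₀ hrj', div_self hdA, one_smul]
      rw [h.d_succ, inner_add_left, inner_smul_left]
      simp only [conj_trivial]
      rcases Nat.lt_succ_iff_lt_or_eq.1 hj with hj' | rfl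
      · rw [ih2 j hj', e, inner_smul_right, inner_sub_right, hrr j hj, hrr (j + 1) (by omega)]
        simp
      · have e2 : ⟪r (j + 1), A (d j)⟫
            = (⟪d j, A (d j)⟫ / ⟪r j, r j⟫) * (0 - ⟪r (j + 1), r (j + 1)⟫) := by
          conv_lhs => rw [e]
          rw [inner_smul_right, inner_sub_right, hrr j hj]
        rw [e2]
        field_simp
        ring
    · rw [h.d_succ, inner_add_right, inner_smul_right, hrd k (by omega)]
      simp

theorem inner_r_r (h : IsCGRun A x r d) (hsymm : ∀ u w, ⟪A u, w⟫ = ⟪u, A w⟫)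
    (hpos : ∀ u, u ≠ 0 → 0 < ⟪u, A u⟫) {j k : ℕ} (hj : j < k) : ⟪r k, r j⟫ = 0 := by
  have hrd := (h.orthogonality hsymm hpos k).1
  cases j with
  | zero => rw [← h.d_zero]; exact hrd 0 hj
  | succ j =>
    have e : r (j + 1) = d (j + 1) - (⟪r (j + 1), r (j + 1)⟫ / ⟪r j, r j⟫) • d j := by
      rw [h.d_succ]; abel
    rw [e, inner_sub_right, inner_smul_right, hrd _ hj, hrd j (by omega)]
    simp

/-- This turns the energy at step `k` into the linear expression ⟪r k, y − x 0⟫, which can be summed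
over `k`. -/
theorem inner_r_sub (h : IsCGRun A x r d) (hsymm : ∀ u w, ⟪A u, w⟫ = ⟪u, A w⟫)
    (hpos : ∀ u, u ≠ 0 → 0 < ⟪u, A u⟫) (k : ℕ) : ⟪r k, x k - x 0⟫ = 0 := by
  have hrd := (h.orthogonality hsymm hpos k).1
  have : ∀ j ≤ k, ⟪r k, x j - x 0⟫ = 0 := by
    intro j
    induction j with
    | zero => simp
    | succ j ih =>
      intro hj
      rw [h.x_succ, add_sub_right_comm, inner_add_right, ih (by omega), inner_smul_right,
        hrd j (by omega)]
      simp
  exact this k le_rfl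

theorem r_eq (h : IsCGRun A x r d) {y : E} (h0 : r 0 = A (y - x 0)) (k : ℕ) :
    r k = A (y - x k) := by
  induction k with
  | zero => exact h0
  | succ k ih => rw [h.r_succ, h.x_succ, ← sub_sub, map_sub A (y - x k), map_smul, ← ih]

/-- Pythagoras in the energy product: `r (k + 1)` is `d (k + 1)` minus a conjugate multiple of `d
k`, so its form value is at least that of `d (k + 1)`. Consequently the step length is at least 1/L.
-/
theorem inner_d_le (h : IsCGRun A x r d) (hsymm : ∀ u w, ⟪A u, w⟫ = ⟪u, A w⟫)
    (hpos : ∀ u, u ≠ 0 → 0 < ⟪u, A u⟫) (hL : ∀ u, ⟪u, A u⟫ ≤ L * ‖u‖ ^ 2) (k : ℕ) :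
    ⟪d k, A (d k)⟫ ≤ L * ‖r k‖ ^ 2 := by
  refine le_trans ?_ (hL (r k))
  cases k with
  | zero => rw [h.d_zero]
  | succ k =>
    set ζ := ⟪r (k + 1), r (k + 1)⟫ / ⟪r k, r k⟫ with hζ
    have e : r (k + 1) = d (k + 1) - ζ • d k := by rw [h.d_succ]; abel
    have o : ⟪d (k + 1), A (d k)⟫ = 0 := (h.orthogonality hsymm hpos (k + 1)).2.1 k (by omega)
    have o' : ⟪d k, A (d (k + 1))⟫ = 0 := by rw [← hsymm, real_inner_comm, o]
    have hn : 0 ≤ ⟪d k, A (d k)⟫ := by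
      by_cases hz : d k = 0
      · simp [hz]
      · exact (hpos _ hz).le
    rw [e, map_sub, map_smul]
    simp only [inner_sub_left, inner_sub_right, inner_smul_left, inner_smul_right, o, o',
      conj_trivial]
    nlinarith [mul_nonneg (sq_nonneg ζ) hn]

/-- One step decreases the energy by at least `‖r‖² / L` (with the energy `⟪e, A e⟫`). -/
theorem energy_decrease (h : IsCGRun A x r d) (hsymm : ∀ u w, ⟪A u, w⟫ = ⟪u, A w⟫)
    (hpos : ∀ u, u ≠ 0 → 0 < ⟪u, A u⟫) (hL : ∀ u, ⟪u, A u⟫ ≤ L * ‖u‖ ^ 2)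
    {y : E} (h0 : r 0 = A (y - x 0)) (k : ℕ) :
    ‖r k‖ ^ 2 ≤ L * (⟪y - x k, A (y - x k)⟫ - ⟪y - x (k + 1), A (y - x (k + 1))⟫) := by
  by_cases hz : r k = 0
  · have hd := h.d_eq_zero hz
    have : x (k + 1) = x k := by rw [h.x_succ, hd]; simp
    rw [this, hz]; simp
  have o := (h.orthogonality hsymm hpos k).2.2
  have hd : d k ≠ 0 := fun h0 => by
    rw [h0, inner_zero_right] at o
    exact hz (inner_self_eq_zero.1 o.symm)
  have hdA := hpos _ hd
  have hle := h.inner_d_le hsymm hpos hL k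
  set η := ⟪r k, r k⟫ / ⟪d k, A (d k)⟫ with hη
  have e : y - x (k + 1) = (y - x k) - η • d k := by rw [h.x_succ]; abel
  have hr := h.r_eq h0 k
  have e1 : ⟪d k, A (y - x k)⟫ = ‖r k‖ ^ 2 := by
    rw [← hr, real_inner_comm, o, real_inner_self_eq_norm_sq]
  have e2 : ⟪y - x k, A (d k)⟫ = ‖r k‖ ^ 2 := by rw [← hsymm, real_inner_comm, e1]
  have e3 : ⟪y - x (k + 1), A (y - x (k + 1))⟫ = ⟪y - x k, A (y - x k)⟫
      - 2 * η * ‖r k‖ ^ 2 + η * (η * ⟪d k, A (d k)⟫) := by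
    rw [e, map_sub, map_smul]
    simp only [inner_sub_left, inner_sub_right, inner_smul_left, inner_smul_right, e1, e2,
      conj_trivial]
    ring
  have e4 : η * ⟪d k, A (d k)⟫ = ‖r k‖ ^ 2 := by
    rw [hη, real_inner_self_eq_norm_sq]; field_simp
  rw [e3, e4]
  have hrpos : 0 < ‖r k‖ ^ 2 := by positivity
  have hη1 : 1 ≤ L * η := by
    rw [hη, real_inner_self_eq_norm_sq, ← mul_div_assoc, le_div_iff₀ hdA]; linarith
  nlinarith

theorem norm_sum_smul_sq (h : IsCGRun A x r d) (hsymm : ∀ u w, ⟪A u, w⟫ = ⟪u, A w⟫)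
    (hpos : ∀ u, u ≠ 0 → 0 < ⟪u, A u⟫) (w : ℕ → ℝ) (m : ℕ) :
    ‖∑ k ∈ Finset.range m, w k • r k‖ ^ 2 = ∑ k ∈ Finset.range m, w k ^ 2 * ‖r k‖ ^ 2 := by
  induction m with
  | zero => simp
  | succ m ih =>
    have : ⟪∑ k ∈ Finset.range m, w k • r k, w m • r m⟫ = 0 := by
      rw [sum_inner]
      refine Finset.sum_eq_zero fun k hk => ?_
      rw [inner_smul_left, inner_smul_right, real_inner_comm,
        h.inner_r_r hsymm hpos (Finset.mem_range.1 hk)]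
      simp
    rw [Finset.sum_range_succ, Finset.sum_range_succ, norm_add_sq_real, this, ih, norm_smul,
      mul_pow, Real.norm_eq_abs, sq_abs]
    ring

/-- The `1 / m²` energy bound of the conjugate-gradient method. -/
theorem energy_bound (h : IsCGRun A x r d) (hsymm : ∀ u w, ⟪A u, w⟫ = ⟪u, A w⟫)
    (hpos : ∀ u, u ≠ 0 → 0 < ⟪u, A u⟫) (hL0 : 0 < L) (hL : ∀ u, ⟪u, A u⟫ ≤ L * ‖u‖ ^ 2)
    {y : E} (h0 : r 0 = A (y - x 0)) (m : ℕ) :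
    (m : ℝ) ^ 2 * ⟪y - x m, A (y - x m)⟫ ≤ 4 * L * ‖y - x 0‖ ^ 2 := by
  set ε : ℕ → ℝ := fun k => ⟪y - x k, A (y - x k)⟫ with hε
  have hε0 : ∀ k, 0 ≤ ε k := fun k => by
    by_cases hz : y - x k = 0
    · simp [hε, hz]
    · exact (hpos _ hz).le
  have hdec : ∀ k, ‖r k‖ ^ 2 ≤ L * (ε k - ε (k + 1)) := h.energy_decrease hsymm hpos hL h0
  have hanti : Antitone ε := antitone_nat_of_succ_le fun k => by
    nlinarith [hdec k, sq_nonneg ‖r k‖]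
  -- The weighted sum of energies is bounded above through its own square root: S is an inner
  -- product with Σ (k+1) r k, whose squared norm is at most 2LS. Hence S ≤ 2L‖y − x 0‖².
  set S := ∑ k ∈ Finset.range m, ((k : ℝ) + 1) * ε k with hS
  have hS0 : 0 ≤ S := Finset.sum_nonneg fun k _ => by have := hε0 k; positivity
  -- Summation by parts, with (k+1)² − k² = 2k + 1 ≤ 2(k+1).
  have habel : ∀ m : ℕ, ∑ k ∈ Finset.range m, ((k : ℝ) + 1) ^ 2 * (ε k - ε (k + 1))
      ≤ 2 * ∑ k ∈ Finset.range m, ((k : ℝ) + 1) * ε k - m ^ 2 * ε m := by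
    intro m
    induction m with
    | zero => simp
    | succ m ih =>
      rw [Finset.sum_range_succ, Finset.sum_range_succ]
      push_cast
      nlinarith [hε0 m]
  have hsum : ∑ k ∈ Finset.range m, ((k : ℝ) + 1) ^ 2 * ‖r k‖ ^ 2 ≤ 2 * L * S := by
    calc _ ≤ ∑ k ∈ Finset.range m, L * (((k : ℝ) + 1) ^ 2 * (ε k - ε (k + 1))) := by
          refine Finset.sum_le_sum fun k _ => ?_
          nlinarith [mul_le_mul_of_nonneg_left (hdec k) (sq_nonneg ((k : ℝ) + 1))]
      _ = L * ∑ k ∈ Finset.range m, ((k : ℝ) + 1) ^ 2 * (ε k - ε (k + 1)) := by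
          rw [Finset.mul_sum]
      _ ≤ L * (2 * S) := by
          refine mul_le_mul_of_nonneg_left ?_ hL0.le
          nlinarith [habel m, mul_nonneg (sq_nonneg (m : ℝ)) (hε0 m)]
      _ = _ := by ring
  have hεr : ∀ k, ε k = ⟪r k, y - x 0⟫ := fun k => by
    have e : y - x 0 = (y - x k) + (x k - x 0) := by abel
    rw [e, inner_add_right, h.inner_r_sub hsymm hpos, add_zero, h.r_eq h0 k, hε]
    exact real_inner_comm _ _
  have hS1 : S ≤ ‖∑ k ∈ Finset.range m, ((k : ℝ) + 1) • r k‖ * ‖y - x 0‖ := by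
    refine le_trans (le_of_eq ?_) (real_inner_le_norm _ _)
    rw [hS, sum_inner]
    exact Finset.sum_congr rfl fun k _ => by rw [inner_smul_left, hεr]; simp
  have hS2 : S ^ 2 ≤ (2 * L * S) * ‖y - x 0‖ ^ 2 := by
    calc S ^ 2 ≤ (‖∑ k ∈ Finset.range m, ((k : ℝ) + 1) • r k‖ * ‖y - x 0‖) ^ 2 :=
          pow_le_pow_left₀ hS0 hS1 2
      _ ≤ _ := by
          rw [mul_pow, h.norm_sum_smul_sq hsymm hpos]
          exact mul_le_mul_of_nonneg_right hsum (sq_nonneg _)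
  have hS3 : S ≤ 2 * L * ‖y - x 0‖ ^ 2 := by
    rcases hS0.eq_or_lt with h0 | hpos
    · rw [← h0]; positivity
    · refine le_of_mul_le_mul_right ?_ hpos
      nlinarith
  -- The energies decrease, so each term of S can be replaced by its value at `m`; the weights sum
  -- to at least m²/2.
  have hlow : ∀ m' : ℕ, (∀ k ≤ m', ε m ≤ ε k) →
      (m' : ℝ) ^ 2 * ε m ≤ 2 * ∑ k ∈ Finset.range m', ((k : ℝ) + 1) * ε k := by
    intro m' hm'
    have hm := hε0 m
    induction m' with
    | zero => simp
    | succ m' ih =>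
      have ih := ih fun k hk => hm' k (by omega)
      have h1 := hm' m' (by omega)
      rw [Finset.sum_range_succ]
      push_cast
      nlinarith [mul_le_mul_of_nonneg_left h1 (by positivity : (0 : ℝ) ≤ (m' : ℝ) + 1)]
  have := hlow m fun k hk => hanti hk
  linarith

/-- After `4 √(L / μ)` conjugate-gradient steps the Euclidean error is halved. -/
theorem norm_error_le (h : IsCGRun A x r d) (hsymm : ∀ u w, ⟪A u, w⟫ = ⟪u, A w⟫)
    (hμ : 0 < μ) (hlow : ∀ u, μ * ‖u‖ ^ 2 ≤ ⟪u, A u⟫) (hL0 : 0 < L)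
    (hL : ∀ u, ⟪u, A u⟫ ≤ L * ‖u‖ ^ 2) {y : E} (h0 : r 0 = A (y - x 0)) {m : ℕ}
    (hm : 4 * √(L / μ) ≤ m) : ‖x m - y‖ ≤ 1 / 2 * ‖x 0 - y‖ := by
  have hpos : ∀ u, u ≠ 0 → 0 < ⟪u, A u⟫ := fun u hu =>
    lt_of_lt_of_le (by positivity) (hlow u)
  have hb := h.energy_bound hsymm hpos hL0 hL h0 m
  -- With 16 L/μ ≤ m² the energy bound leaves a squared error of at most 1/4 of the initial one.
  have hm2 : 16 * (L / μ) ≤ (m : ℝ) ^ 2 := by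
    have := pow_le_pow_left₀ (by positivity) hm 2
    rw [mul_pow, Real.sq_sqrt (by positivity)] at this
    linarith
  have h1 : 16 * L * ‖y - x m‖ ^ 2 ≤ 4 * L * ‖y - x 0‖ ^ 2 := by
    calc 16 * L * ‖y - x m‖ ^ 2 = 16 * (L / μ) * (μ * ‖y - x m‖ ^ 2) := by field_simp
      _ ≤ (m : ℝ) ^ 2 * ⟪y - x m, A (y - x m)⟫ :=
          mul_le_mul hm2 (hlow _) (by positivity) (by positivity)
      _ ≤ _ := hb
  rw [norm_sub_rev (x m), norm_sub_rev (x 0)]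
  refine abs_le_of_sq_le_sq' ?_ (by positivity) |>.2
  rw [mul_pow]
  refine le_of_mul_le_mul_left ?_ (by positivity : 0 < 16 * L)
  linarith

end IsCGRun

end ConjugateGradient

/-! ### First-order inequalities for convex and for smooth functions. -/

section Convexity

variable {E : Type*} [NormedAddCommGroup E] [InnerProductSpace ℝ E] [CompleteSpace E]

theorem hasDerivAt_comp_ray {h : E → ℝ} {x v G : E} {t : ℝ} (hG : HasGradientAt h G (x + t • v)) :
    HasDerivAt (fun s : ℝ => h (x + s • v)) (inner ℝ G v) t := by
  have h1 : HasDerivAt (fun s : ℝ => x + s • v) v t := by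
    simpa using ((hasDerivAt_id t).smul_const v).const_add x
  have := hG.hasFDerivAt.comp_hasDerivAt t h1
  rwa [InnerProductSpace.toDual_apply_apply] at this

theorem convexOn_le_of_hasGradientAt {h : E → ℝ} (hc : ConvexOn ℝ Set.univ h) {x G : E}
    (hG : HasGradientAt h G x) (y : E) : h x + inner ℝ G (y - x) ≤ h y := by
  have hd : HasDerivAt (fun s : ℝ => h (x + s • (y - x))) (inner ℝ G (y - x)) 0 :=
    hasDerivAt_comp_ray (by simpa using hG)
  have hcv : ConvexOn ℝ Set.univ (fun s : ℝ => h (x + s • (y - x))) := by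
    have := hc.comp_affineMap (AffineMap.lineMap x y : ℝ →ᵃ[ℝ] E)
    rw [Set.preimage_univ] at this
    refine this.congr fun s _ => ?_
    simp [AffineMap.lineMap_apply, add_comm]
  have := hcv.le_slope_of_hasDerivAt (Set.mem_univ 0) (Set.mem_univ 1) one_pos hd
  simp only [slope_def_field, one_smul, zero_smul, add_zero, add_sub_cancel, sub_zero,
    div_one] at this
  linarith

theorem strongConvexOn_le_of_hasGradientAt {h : E → ℝ} {μ : ℝ}
    (hc : StrongConvexOn Set.univ μ h) {x G : E} (hG : HasGradientAt h G x) (y : E) :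
    h x + inner ℝ G (y - x) + μ / 2 * ‖y - x‖ ^ 2 ≤ h y := by
  have hc' := strongConvexOn_iff_convex.1 hc
  have hsq : HasGradientAt (fun z : E => h z - μ / 2 * ‖z‖ ^ 2) (G - μ • x) x := by
    rw [hasGradientAt_iff_hasFDerivAt]
    refine (hG.hasFDerivAt.sub
      ((hasStrictFDerivAt_norm_sq x).hasFDerivAt.const_mul (μ / 2))).congr_fderiv ?_
    ext v
    simp
    ring
  have := convexOn_le_of_hasGradientAt hc' hsq y
  have e : ‖y - x‖ ^ 2 = ‖y‖ ^ 2 - 2 * inner ℝ x y + ‖x‖ ^ 2 := by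
    rw [norm_sub_sq_real, real_inner_comm]
  have e2 : inner ℝ x (y - x) = inner ℝ x y - ‖x‖ ^ 2 := by
    rw [inner_sub_right, real_inner_self_eq_norm_sq]
  rw [inner_sub_left, inner_smul_left, e2] at this
  simp only [conj_trivial] at this
  rw [e]
  linarith

/-- The descent inequality for a function with Lipschitz gradient. -/
theorem le_of_lipschitz_gradient {F : E → ℝ} {G : E → E} (hG : ∀ x, HasGradientAt F (G x) x)
    {L : ℝ} (hL : ∀ x y, ‖G x - G y‖ ≤ L * ‖x - y‖) (x v : E) :
    F (x + v) ≤ F x + inner ℝ (G x) v + L / 2 * ‖v‖ ^ 2 := by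
  -- The difference between `F` on the segment and its quadratic majorant; the Lipschitz bound makes
  -- its derivative nonpositive.
  set ψ : ℝ → ℝ := fun t => F (x + t • v) - (t * inner ℝ (G x) v + L / 2 * ‖v‖ ^ 2 * t ^ 2)
    with hψ
  have hd : ∀ t, HasDerivAt ψ (inner ℝ (G (x + t • v)) v
      - (inner ℝ (G x) v + L / 2 * ‖v‖ ^ 2 * (2 * t))) t := by
    intro t
    refine (hasDerivAt_comp_ray (hG _)).sub (HasDerivAt.add ?_ ?_)
    · simpa using (hasDerivAt_id t).mul_const (inner ℝ (G x) v)
    · simpa using (hasDerivAt_pow 2 t).const_mul (L / 2 * ‖v‖ ^ 2)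
  have hanti : AntitoneOn ψ (Set.Icc 0 1) := by
    refine antitoneOn_of_deriv_nonpos (convex_Icc 0 1)
      (fun t _ => (hd t).continuousAt.continuousWithinAt)
      (fun t _ => (hd t).differentiableAt.differentiableWithinAt) fun t ht => ?_
    rw [interior_Icc] at ht
    rw [(hd t).deriv]
    have h1 : inner ℝ (G (x + t • v) - G x) v ≤ L * (t * ‖v‖) * ‖v‖ := by
      refine (real_inner_le_norm _ _).trans (mul_le_mul_of_nonneg_right ?_ (norm_nonneg _))
      refine (hL _ _).trans (le_of_eq ?_)
      rw [add_sub_cancel_left, norm_smul, Real.norm_of_nonneg ht.1.le]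
    rw [inner_sub_left] at h1
    nlinarith
  have := hanti (Set.left_mem_Icc.2 zero_le_one) (Set.right_mem_Icc.2 zero_le_one) zero_le_one
  simp only [hψ, one_smul, zero_smul, add_zero] at this
  linarith

end Convexity

/-! ### Operator norm from the quadratic form. -/

section SymmetricOperators

variable {E : Type*} [NormedAddCommGroup E] [InnerProductSpace ℝ E]

/-- A symmetric operator with quadratic form between `0` and `c` has norm at most `c`. -/
theorem norm_apply_le_of_inner_le {S : E →L[ℝ] E} (hsymm : ∀ u w, inner ℝ (S u) w = inner ℝ u (S w))
    (hpos : ∀ u, 0 ≤ inner ℝ u (S u)) {c : ℝ} (hc0 : 0 ≤ c)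
    (hc : ∀ u, inner ℝ u (S u) ≤ c * ‖u‖ ^ 2) (u : E) : ‖S u‖ ≤ c * ‖u‖ := by
  -- the form at `t u + S u` is a nonnegative quadratic polynomial in `t`
  have h1 : ‖S u‖ ^ 2 * ‖S u‖ ^ 2 ≤ inner ℝ u (S u) * inner ℝ (S u) (S (S u)) := by
    have key : ∀ t : ℝ, 0 ≤ inner ℝ u (S u) * (t * t) + 2 * ‖S u‖ ^ 2 * t
        + inner ℝ (S u) (S (S u)) := by
      intro t
      have := hpos (t • u + S u)
      simp only [map_add, map_smul, inner_add_left, inner_add_right, inner_smul_left,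
        inner_smul_right, conj_trivial] at this
      rw [← hsymm u (S u), real_inner_self_eq_norm_sq] at this
      linarith
    have := discrim_le_zero key
    unfold discrim at this
    linarith
  have h2 : ‖S u‖ ^ 2 * ‖S u‖ ^ 2 ≤ (c * ‖u‖) ^ 2 * ‖S u‖ ^ 2 := by
    calc _ ≤ _ := h1
      _ ≤ (c * ‖u‖ ^ 2) * (c * ‖S u‖ ^ 2) := mul_le_mul (hc u) (hc _) (hpos _) (by positivity)
      _ = _ := by ring
  by_cases hz : S u = 0
  · rw [hz, norm_zero]; positivity
  · have : 0 < ‖S u‖ := norm_pos_iff.2 hz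
    exact abs_le_of_sq_le_sq' (le_of_mul_le_mul_right h2 (by positivity)) (by positivity) |>.2

end SymmetricOperators

/-! ### Partial gradients of functions of the pair (θ, φ). -/

section Pairs

variable {p q : ℕ}

theorem norm_toLp_le (a : Vec p) (b : Vec q) :
    ‖(WithLp.toLp 2 (a, b) : Pair p q)‖ ≤ ‖a‖ + ‖b‖ := by
  rw [WithLp.prod_norm_eq_of_L2]
  refine Real.sqrt_le_iff.2 ⟨by positivity, ?_⟩
  change ‖a‖ ^ 2 + ‖b‖ ^ 2 ≤ _
  nlinarith [mul_nonneg (norm_nonneg a) (norm_nonneg b)]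

theorem norm_toLp_sub_le (a a' : Vec p) (b b' : Vec q) :
    ‖(WithLp.toLp 2 (a, b) : Pair p q) - WithLp.toLp 2 (a', b')‖ ≤ ‖a - a'‖ + ‖b - b'‖ :=
  norm_toLp_le (a - a') (b - b')

/-- A Lipschitz function of the pair is Lipschitz for the sum of the two distances. -/
theorem norm_joint_sub_le {X : Type*} [SeminormedAddCommGroup X] {l : ℝ≥0}
    {h : Vec p → Vec q → X} (hl : LipschitzWith l (joint h)) (θ θ' : Vec p) (φ φ' : Vec q) :
    ‖h θ φ - h θ' φ'‖ ≤ l * (‖θ - θ'‖ + ‖φ - φ'‖) :=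
  (hl.norm_sub_le (WithLp.toLp 2 (θ, φ)) (WithLp.toLp 2 (θ', φ'))).trans
    (mul_le_mul_of_nonneg_left (norm_toLp_sub_le _ _ _ _) l.coe_nonneg)

theorem hasFDerivAt_toPair {X : Type*} [NormedAddCommGroup X] [NormedSpace ℝ X] {u : X → Vec p}
    {w : X → Vec q} {u' : X →L[ℝ] Vec p} {w' : X →L[ℝ] Vec q} {x : X} (hu : HasFDerivAt u u' x)
    (hw : HasFDerivAt w w' x) :
    HasFDerivAt (fun y => (WithLp.toLp 2 (u y, w y) : Pair p q))
      (((WithLp.prodContinuousLinearEquiv 2 ℝ (Vec p) (Vec q)).symm :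
        (Vec p × Vec q) →L[ℝ] Pair p q) ∘L (u'.prod w')) x :=
  ((WithLp.prodContinuousLinearEquiv 2 ℝ (Vec p) (Vec q)).symm :
    (Vec p × Vec q) →L[ℝ] Pair p q).hasFDerivAt.comp x (hu.prodMk hw)

theorem hasFDerivAt_comp_pair {X : Type*} [NormedAddCommGroup X] [NormedSpace ℝ X]
    {Y : Type*} [NormedAddCommGroup Y] [NormedSpace ℝ Y] {h : Vec p → Vec q → Y}
    {D : Pair p q →L[ℝ] Y} {u : X → Vec p}
    {w : X → Vec q} {u' : X →L[ℝ] Vec p} {w' : X →L[ℝ] Vec q} {x : X}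
    (hD : HasFDerivAt (joint h) D (WithLp.toLp 2 (u x, w x))) (hu : HasFDerivAt u u' x)
    (hw : HasFDerivAt w w' x) :
    HasFDerivAt (fun y => h (u y) (w y))
      (D ∘L (((WithLp.prodContinuousLinearEquiv 2 ℝ (Vec p) (Vec q)).symm :
        (Vec p × Vec q) →L[ℝ] Pair p q) ∘L (u'.prod w'))) x :=
  HasFDerivAt.comp (g := joint h) x hD (hasFDerivAt_toPair hu hw)

theorem hasGradientAt_fst {h : Vec p → Vec q → ℝ} (hd : Differentiable ℝ (joint h)) (θ : Vec p)
    (φ : Vec q) : HasGradientAt (fun θ' => h θ' φ)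
      (gradient (joint h) (WithLp.toLp 2 (θ, φ))).fst θ := by
  rw [hasGradientAt_iff_hasFDerivAt]
  have := (hd (WithLp.toLp 2 (θ, φ))).hasGradientAt.hasFDerivAt
  generalize gradient (joint h) (WithLp.toLp 2 (θ, φ)) = G at this ⊢
  refine (hasFDerivAt_comp_pair this (hasFDerivAt_id θ)
    (hasFDerivAt_const φ θ)).congr_fderiv ?_
  ext v
  simp [WithLp.prod_inner_apply]

theorem hasGradientAt_snd {h : Vec p → Vec q → ℝ} (hd : Differentiable ℝ (joint h)) (θ : Vec p)
    (φ : Vec q) : HasGradientAt (fun φ' => h θ φ')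
      (gradient (joint h) (WithLp.toLp 2 (θ, φ))).snd φ := by
  rw [hasGradientAt_iff_hasFDerivAt]
  have := (hd (WithLp.toLp 2 (θ, φ))).hasGradientAt.hasFDerivAt
  generalize gradient (joint h) (WithLp.toLp 2 (θ, φ)) = G at this ⊢
  refine (hasFDerivAt_comp_pair this (hasFDerivAt_const θ φ)
    (hasFDerivAt_id φ)).congr_fderiv ?_
  ext v
  simp [WithLp.prod_inner_apply]

theorem gradTheta_eq {h : Vec p → Vec q → ℝ} (hd : Differentiable ℝ (joint h)) (θ : Vec p)
    (φ : Vec q) : gradTheta h θ φ = (gradient (joint h) (WithLp.toLp 2 (θ, φ))).fst :=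
  (hasGradientAt_fst hd θ φ).gradient

theorem gradPhi_eq {h : Vec p → Vec q → ℝ} (hd : Differentiable ℝ (joint h)) (θ : Vec p)
    (φ : Vec q) : gradPhi h θ φ = (gradient (joint h) (WithLp.toLp 2 (θ, φ))).snd :=
  (hasGradientAt_snd hd θ φ).gradient

theorem hasGradientAt_gradPhi {h : Vec p → Vec q → ℝ} (hd : Differentiable ℝ (joint h))
    (θ : Vec p) (φ : Vec q) : HasGradientAt (fun φ' => h θ φ') (gradPhi h θ φ) φ := by
  rw [gradPhi_eq hd]; exact hasGradientAt_snd hd θ φ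

theorem norm_gradTheta_sub_le {h : Vec p → Vec q → ℝ} (hd : Differentiable ℝ (joint h)) {l : ℝ≥0}
    (hl : LipschitzWith l (gradient (joint h))) (θ θ' : Vec p) (φ φ' : Vec q) :
    ‖gradTheta h θ φ - gradTheta h θ' φ'‖ ≤ l * (‖θ - θ'‖ + ‖φ - φ'‖) := by
  rw [gradTheta_eq hd, gradTheta_eq hd]
  exact ((WithLp.norm_fst_le _ (gradient (joint h) _ - gradient (joint h) _)).trans
    (hl.norm_sub_le _ _)).trans
    (mul_le_mul_of_nonneg_left (norm_toLp_sub_le _ _ _ _) l.coe_nonneg)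

theorem norm_gradPhi_sub_le {h : Vec p → Vec q → ℝ} (hd : Differentiable ℝ (joint h)) {l : ℝ≥0}
    (hl : LipschitzWith l (gradient (joint h))) (θ θ' : Vec p) (φ φ' : Vec q) :
    ‖gradPhi h θ φ - gradPhi h θ' φ'‖ ≤ l * (‖θ - θ'‖ + ‖φ - φ'‖) := by
  rw [gradPhi_eq hd, gradPhi_eq hd]
  exact ((WithLp.norm_snd_le _ (gradient (joint h) _ - gradient (joint h) _)).trans
    (hl.norm_sub_le _ _)).trans
    (mul_le_mul_of_nonneg_left (norm_toLp_sub_le _ _ _ _) l.coe_nonneg)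

theorem norm_gradPhi_le {h : Vec p → Vec q → ℝ} (hd : Differentiable ℝ (joint h)) {l : ℝ≥0}
    (hl : LipschitzWith l (joint h)) (θ : Vec p) (φ : Vec q) : ‖gradPhi h θ φ‖ ≤ l := by
  rw [gradPhi_eq hd]
  refine (WithLp.norm_snd_le _ _).trans ?_
  rw [gradient, LinearIsometryEquiv.norm_map]
  exact norm_fderiv_le_of_lipschitz ℝ hl

/-- Chain rule for a real function of the pair along a curve of pairs. -/
theorem hasGradientAt_comp_curve {h : Vec p → Vec q → ℝ} (hd : Differentiable ℝ (joint h))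
    {w : Vec p → Vec q} {w' : Vec p →L[ℝ] Vec q} {θ : Vec p} (hw : HasFDerivAt w w' θ) :
    HasGradientAt (fun θ' => h θ' (w θ'))
      (gradTheta h θ (w θ) + w'.adjoint (gradPhi h θ (w θ))) θ := by
  rw [hasGradientAt_iff_hasFDerivAt]
  have := (hd (WithLp.toLp 2 (θ, w θ))).hasGradientAt.hasFDerivAt
  rw [gradTheta_eq hd, gradPhi_eq hd]
  generalize gradient (joint h) (WithLp.toLp 2 (θ, w θ)) = G at this ⊢
  refine (hasFDerivAt_comp_pair this (hasFDerivAt_id θ) hw).congr_fderiv ?_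
  ext v
  simp [WithLp.prod_inner_apply, ContinuousLinearMap.adjoint_inner_left]

end Pairs

/-! ### A single task: lower-level solution, linear system and hypergradient. -/

variable {p q : ℕ}

/-- A task that satisfies all assumptions: strong convexity of the lower level and smoothness. -/
structure RegularTask (μ : ℝ) (lf0 lf lg lg1 lg2 : ℝ≥0) (f g : Vec p → Vec q → ℝ) : Prop where
  mu_pos : 0 < μ
  dim_pos : 0 < q
  convex : ∀ θ, StrongConvexOn Set.univ μ (g θ)
  smooth : TaskSmooth lf0 lf lg lg1 lg2 f g

/-- The exact solution of the linear system that the conjugate-gradient method is applied to. -/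
def linearSolution (f g : Vec p → Vec q → ℝ) (θ : Vec p) (φ : Vec q) : Vec q :=
  (hessPhi g θ φ).inverse (gradPhi f θ φ)

/-- The hypergradient formula, evaluated at arbitrary approximations `φ` and `v` of the lower-level
solution and of the Hessian-inverse-vector product. -/
def hypergradientAt (f g : Vec p → Vec q → ℝ) (θ : Vec p) (φ v : Vec q) : Vec p :=
  gradTheta f θ φ - jacThetaPhi g θ φ v

namespace RegularTask

variable {μ : ℝ} {lf0 lf lg lg1 lg2 : ℝ≥0} {f g : Vec p → Vec q → ℝ}

theorem hasFDerivAt_gradPhi_snd (h : RegularTask μ lf0 lf lg lg1 lg2 f g) (θ : Vec p)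
    (φ : Vec q) : HasFDerivAt (fun φ' => gradPhi g θ φ') (hessPhi g θ φ) φ :=
  (hasFDerivAt_comp_pair (h.smooth.differentiable_gradPhi_g _).hasFDerivAt
    (hasFDerivAt_const θ φ) (hasFDerivAt_id φ)).differentiableAt.hasFDerivAt

theorem hasFDerivAt_gradPhi_fst (h : RegularTask μ lf0 lf lg lg1 lg2 f g) (θ : Vec p)
    (φ : Vec q) :
    HasFDerivAt (fun θ' => gradPhi g θ' φ) (jacThetaPhi g θ φ).adjoint θ := by
  rw [jacThetaPhi, ContinuousLinearMap.adjoint_adjoint]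
  exact (hasFDerivAt_comp_pair (h.smooth.differentiable_gradPhi_g _).hasFDerivAt
    (hasFDerivAt_id θ) (hasFDerivAt_const φ θ)).differentiableAt.hasFDerivAt

theorem fderiv_joint_gradPhi (h : RegularTask μ lf0 lf lg lg1 lg2 f g) (θ a : Vec p)
    (φ b : Vec q) : fderiv ℝ (joint (gradPhi g)) (WithLp.toLp 2 (θ, φ)) (WithLp.toLp 2 (a, b))
      = (jacThetaPhi g θ φ).adjoint a + hessPhi g θ φ b := by
  have hD := (h.smooth.differentiable_gradPhi_g (WithLp.toLp 2 (θ, φ))).hasFDerivAt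
  have h1 := (h.hasFDerivAt_gradPhi_fst θ φ).unique
    (hasFDerivAt_comp_pair hD (hasFDerivAt_id θ) (hasFDerivAt_const φ θ))
  have h2 := (h.hasFDerivAt_gradPhi_snd θ φ).unique
    (hasFDerivAt_comp_pair hD (hasFDerivAt_const θ φ) (hasFDerivAt_id φ))
  have e : (WithLp.toLp 2 (a, b) : Pair p q) = WithLp.toLp 2 (a, 0) + WithLp.toLp 2 (0, b) := by
    rw [← WithLp.toLp_add]; simp
  rw [e, map_add, h1, h2]
  simp

theorem norm_hessPhi_le (h : RegularTask μ lf0 lf lg lg1 lg2 f g) (θ : Vec p) (φ : Vec q) :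
    ‖hessPhi g θ φ‖ ≤ lg := by
  refine norm_fderiv_le_of_lipschitz ℝ (LipschitzWith.of_dist_le_mul fun x y => ?_)
  rw [dist_eq_norm, dist_eq_norm]
  simpa using norm_gradPhi_sub_le h.smooth.differentiable_g h.smooth.lipschitz_grad_g θ θ x y

theorem norm_jacThetaPhi_le (h : RegularTask μ lf0 lf lg lg1 lg2 f g) (θ : Vec p) (φ : Vec q) :
    ‖jacThetaPhi g θ φ‖ ≤ lg := by
  rw [jacThetaPhi, LinearIsometryEquiv.norm_map]
  refine norm_fderiv_le_of_lipschitz ℝ (LipschitzWith.of_dist_le_mul fun x y => ?_)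
  rw [dist_eq_norm, dist_eq_norm]
  simpa using norm_gradPhi_sub_le h.smooth.differentiable_g h.smooth.lipschitz_grad_g x y φ φ

theorem hessPhi_symm (h : RegularTask μ lf0 lf lg lg1 lg2 f g) (θ : Vec p) (φ u w : Vec q) :
    inner ℝ (hessPhi g θ φ u) w = inner ℝ u (hessPhi g θ φ w) := by
  -- The Riesz map, repackaged as an ℝ-linear map: `innerSL` is conjugate-linear in its first
  -- argument.
  let T : Vec q →L[ℝ] Vec q →L[ℝ] ℝ :=
    { toFun := fun x => innerSL ℝ x
      map_add' := fun x y => map_add (innerSL ℝ) x y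
      map_smul' := fun c x => by ext; simp
      cont := (innerSL ℝ (E := Vec q)).continuous }
  have h1 : ∀ y, HasFDerivAt (g θ) (T (gradPhi g θ y)) y := fun y =>
    (hasGradientAt_gradPhi h.smooth.differentiable_g θ y).hasFDerivAt
  have h2 : HasFDerivAt (fun y => T (gradPhi g θ y)) (T ∘L hessPhi g θ φ) φ :=
    T.hasFDerivAt.comp φ (h.hasFDerivAt_gradPhi_snd θ φ)
  have := second_derivative_symmetric h1 h2 u w
  rw [real_inner_comm _ u]
  exact this

theorem le_inner_gradPhi_sub (h : RegularTask μ lf0 lf lg lg1 lg2 f g) (θ : Vec p) (x y : Vec q) :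
    μ * ‖x - y‖ ^ 2 ≤ inner ℝ (gradPhi g θ x - gradPhi g θ y) (x - y) := by
  have h1 := strongConvexOn_le_of_hasGradientAt (h.convex θ)
    (hasGradientAt_gradPhi h.smooth.differentiable_g θ x) y
  have h2 := strongConvexOn_le_of_hasGradientAt (h.convex θ)
    (hasGradientAt_gradPhi h.smooth.differentiable_g θ y) x
  rw [← neg_sub x y, inner_neg_right, norm_neg] at h1
  rw [inner_sub_left]
  linarith

theorem mul_norm_sub_le (h : RegularTask μ lf0 lf lg lg1 lg2 f g) (θ : Vec p) (x y : Vec q) :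
    μ * ‖x - y‖ ≤ ‖gradPhi g θ x - gradPhi g θ y‖ := by
  by_cases hz : ‖x - y‖ = 0
  · rw [hz]; simp
  · refine le_of_mul_le_mul_right ?_ (lt_of_le_of_ne (norm_nonneg _) (Ne.symm hz))
    have := (h.le_inner_gradPhi_sub θ x y).trans (real_inner_le_norm _ _)
    linarith

/-- Strong monotonicity of the gradient along the line φ + s u, differentiated at s = 0. -/
theorem mul_norm_sq_le_inner_hessPhi (h : RegularTask μ lf0 lf lg lg1 lg2 f g) (θ : Vec p)
    (φ u : Vec q) : μ * ‖u‖ ^ 2 ≤ inner ℝ u (hessPhi g θ φ u) := by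
  set m : ℝ → ℝ := fun s => inner ℝ (gradPhi g θ (φ + s • u)) u - s * (μ * ‖u‖ ^ 2) with hm
  have hmono : Monotone m := by
    intro s t hst
    rcases hst.eq_or_lt with rfl | hst
    · exact le_rfl
    have := h.le_inner_gradPhi_sub θ (φ + t • u) (φ + s • u)
    rw [add_sub_add_left_eq_sub, ← sub_smul, norm_smul, inner_smul_right, mul_pow,
      Real.norm_eq_abs, sq_abs, inner_sub_left] at this
    have hpos : 0 < t - s := sub_pos.2 hst
    have h2 : (t - s) * (μ * ‖u‖ ^ 2)
        ≤ inner ℝ (gradPhi g θ (φ + t • u)) u - inner ℝ (gradPhi g θ (φ + s • u)) u := by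
      refine le_of_mul_le_mul_left ?_ hpos
      linarith
    simp only [hm]
    linarith
  have hd : HasDerivAt m (inner ℝ (hessPhi g θ φ u) u - μ * ‖u‖ ^ 2) 0 := by
    have h1 : HasDerivAt (fun s : ℝ => φ + s • u) u 0 := by
      simpa using ((hasDerivAt_id (0 : ℝ)).smul_const u).const_add φ
    have h2 : HasDerivAt (fun s : ℝ => gradPhi g θ (φ + s • u)) (hessPhi g θ φ u) 0 := by
      refine HasFDerivAt.comp_hasDerivAt (f := fun s : ℝ => φ + s • u)
        (l := fun φ' => gradPhi g θ φ') 0 ?_ h1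
      simpa using h.hasFDerivAt_gradPhi_snd θ φ
    refine HasDerivAt.sub ?_ ?_
    · simpa using h2.inner ℝ (hasDerivAt_const (0 : ℝ) u)
    · simpa using (hasDerivAt_id (0 : ℝ)).mul_const (μ * ‖u‖ ^ 2)
  have := hmono.deriv_nonneg (x := 0)
  rw [hd.deriv, real_inner_comm] at this
  linarith

theorem inner_hessPhi_le (h : RegularTask μ lf0 lf lg lg1 lg2 f g) (θ : Vec p)
    (φ u : Vec q) : inner ℝ u (hessPhi g θ φ u) ≤ lg * ‖u‖ ^ 2 := by
  have h1 := (real_inner_le_norm u (hessPhi g θ φ u))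
  have h2 := (hessPhi g θ φ).le_of_opNorm_le (h.norm_hessPhi_le θ φ) u
  nlinarith [norm_nonneg u]

/-- The dimension q ≥ 1 supplies a nonzero vector on which to compare both bounds of the Hessian
form. This gives κ ≥ 1, which the choice of constants relies on. -/
theorem mu_le_lg (h : RegularTask μ lf0 lf lg lg1 lg2 f g) : μ ≤ lg := by
  have : Nonempty (Fin q) := ⟨⟨0, h.dim_pos⟩⟩
  obtain ⟨u, hu⟩ := exists_ne (0 : Vec q)
  have := (h.mul_norm_sq_le_inner_hessPhi 0 0 u).trans (h.inner_hessPhi_le 0 0 u)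
  exact le_of_mul_le_mul_right this (by positivity)

theorem lg_pos (h : RegularTask μ lf0 lf lg lg1 lg2 f g) : 0 < (lg : ℝ) :=
  h.mu_pos.trans_le h.mu_le_lg

theorem one_sub_nonneg (h : RegularTask μ lf0 lf lg lg1 lg2 f g) {lam : ℝ} (hlam : 0 < lam)
    (hle : lam ≤ 1 / lg) : 0 ≤ 1 - lam * μ := by
  have := (le_div_iff₀ h.lg_pos).1 hle
  nlinarith [h.mu_le_lg]

/-- A gradient step on the lower-level problem is a contraction. -/
theorem norm_gradStep_sub_le (h : RegularTask μ lf0 lf lg lg1 lg2 f g) {lam : ℝ} (hlam : 0 < lam)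
    (hle : lam ≤ 1 / lg) (θ : Vec p) (x y : Vec q) :
    ‖(x - lam • gradPhi g θ x) - (y - lam • gradPhi g θ y)‖ ≤ (1 - lam * μ) * ‖x - y‖ := by
  have hl := (le_div_iff₀ h.lg_pos).1 hle
  -- The derivative of the gradient step. Its form lies between 0, because λ l_g ≤ 1, and 1 − λμ, so
  -- the mean value inequality applies with that constant.
  set S : Vec q → (Vec q →L[ℝ] Vec q) := fun φ =>
    ContinuousLinearMap.id ℝ (Vec q) - lam • hessPhi g θ φ with hS
  have hin : ∀ φ u, inner ℝ u (S φ u) = ‖u‖ ^ 2 - lam * inner ℝ u (hessPhi g θ φ u) := by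
    intro φ u
    simp [hS, inner_sub_right, inner_smul_right]
  refine Convex.norm_image_sub_le_of_norm_hasFDerivWithin_le
    (f := fun x => x - lam • gradPhi g θ x) (f' := S) (s := Set.univ) (fun φ _ => ?_)
    (fun φ _ => ?_) convex_univ (Set.mem_univ y) (Set.mem_univ x)
  · exact ((hasFDerivAt_id φ).sub
      ((h.hasFDerivAt_gradPhi_snd θ φ).const_smul lam)).hasFDerivWithinAt
  · refine ContinuousLinearMap.opNorm_le_bound _ (h.one_sub_nonneg hlam hle) fun u => ?_
    refine norm_apply_le_of_inner_le (fun u w => ?_) (fun u => ?_)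
      (h.one_sub_nonneg hlam hle) (fun u => ?_) u
    · simp [hS, inner_sub_left, inner_sub_right, inner_smul_left, inner_smul_right,
        h.hessPhi_symm]
    · rw [hin]
      nlinarith [mul_le_mul_of_nonneg_left (h.inner_hessPhi_le θ φ u) hlam.le, sq_nonneg ‖u‖]
    · rw [hin]
      nlinarith [mul_le_mul_of_nonneg_left (h.mul_norm_sq_le_inner_hessPhi θ φ u) hlam.le]

/-- A stationary point is a fixed point of the gradient step with stepsize 1/l_g, which is a
contraction. -/
theorem exists_gradPhi_eq_zero (h : RegularTask μ lf0 lf lg lg1 lg2 f g) (θ : Vec p) :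
    ∃ φ, gradPhi g θ φ = 0 := by
  have hlam : (0 : ℝ) < 1 / lg := one_div_pos.2 h.lg_pos
  have h0 := h.one_sub_nonneg hlam le_rfl
  have hcontr : ContractingWith (1 - 1 / lg * μ).toNNReal
      (fun x => x - (1 / (lg : ℝ)) • gradPhi g θ x) := by
    refine ⟨?_, LipschitzWith.of_dist_le_mul fun x y => ?_⟩
    · have := mul_pos hlam h.mu_pos
      rw [Real.toNNReal_lt_one]
      linarith
    · rw [dist_eq_norm, dist_eq_norm, Real.coe_toNNReal _ h0]
      exact h.norm_gradStep_sub_le hlam le_rfl θ x y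
  refine ⟨hcontr.fixedPoint, ?_⟩
  have := hcontr.fixedPoint_isFixedPt
  rw [Function.IsFixedPt, sub_eq_self, smul_eq_zero] at this
  exact this.resolve_left hlam.ne'

/-- The choice in `phiStar` is meaningful only once a minimiser exists; by strong convexity the
stationary point is one. -/
theorem gradPhi_phiStar (h : RegularTask μ lf0 lf lg lg1 lg2 f g) (θ : Vec p) :
    gradPhi g θ (phiStar g θ) = 0 := by
  obtain ⟨φ, hφ⟩ := h.exists_gradPhi_eq_zero θ
  have hmin : ∀ φ', g θ φ ≤ g θ φ' := fun φ' => by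
    have := strongConvexOn_le_of_hasGradientAt (h.convex θ)
      (hasGradientAt_gradPhi h.smooth.differentiable_g θ φ) φ'
    rw [hφ, inner_zero_left] at this
    have : 0 ≤ μ / 2 * ‖φ' - φ‖ ^ 2 := by have := h.mu_pos; positivity
    linarith
  have hstar : ∀ φ', g θ (phiStar g θ) ≤ g θ φ' :=
    Classical.epsilon_spec (p := fun φ => ∀ φ', g θ φ ≤ g θ φ') ⟨φ, hmin⟩
  have hloc : IsLocalMin (fun φ' => g θ φ') (phiStar g θ) := Filter.Eventually.of_forall hstar
  rw [gradPhi, gradient, hloc.fderiv_eq_zero, map_zero]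

theorem norm_phiStar_sub_le (h : RegularTask μ lf0 lf lg lg1 lg2 f g) (θ θ' : Vec p) :
    ‖phiStar g θ - phiStar g θ'‖ ≤ lg / μ * ‖θ - θ'‖ := by
  rw [div_mul_eq_mul_div, le_div_iff₀ h.mu_pos, mul_comm]
  refine (h.mul_norm_sub_le θ _ _).trans ?_
  have := norm_gradPhi_sub_le h.smooth.differentiable_g h.smooth.lipschitz_grad_g θ' θ
    (phiStar g θ') (phiStar g θ')
  rw [h.gradPhi_phiStar] at this ⊢
  simpa [norm_sub_rev θ' θ] using this

theorem isInvertible_hessPhi (h : RegularTask μ lf0 lf lg lg1 lg2 f g) (θ : Vec p) (φ : Vec q) :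
    (hessPhi g θ φ).IsInvertible := by
  have hinj : Function.Injective (hessPhi g θ φ : Vec q →ₗ[ℝ] Vec q) := by
    refine (injective_iff_map_eq_zero _).2 fun u hu => ?_
    have h1 := h.mul_norm_sq_le_inner_hessPhi θ φ u
    have hu' : hessPhi g θ φ u = 0 := hu
    rw [hu', inner_zero_right] at h1
    have hμ := h.mu_pos
    by_contra hne
    have : 0 < μ * ‖u‖ ^ 2 := by positivity
    linarith
  exact ⟨(LinearEquiv.ofInjectiveEndo _ hinj).toContinuousLinearEquiv, by ext; rfl⟩

theorem mul_norm_le_norm_hessPhi (h : RegularTask μ lf0 lf lg lg1 lg2 f g) (θ : Vec p)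
    (φ u : Vec q) : μ * ‖u‖ ≤ ‖hessPhi g θ φ u‖ := by
  by_cases hz : ‖u‖ = 0
  · rw [hz]; simp
  · refine le_of_mul_le_mul_right ?_ (lt_of_le_of_ne (norm_nonneg _) (Ne.symm hz))
    have := (h.mul_norm_sq_le_inner_hessPhi θ φ u).trans (real_inner_le_norm _ _)
    linarith

theorem hessPhi_inverse_apply (h : RegularTask μ lf0 lf lg lg1 lg2 f g) (θ : Vec p) (φ b : Vec q) :
    hessPhi g θ φ ((hessPhi g θ φ).inverse b) = b :=
  ((h.isInvertible_hessPhi θ φ).inverse_apply_eq.1 rfl).symm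

theorem inverse_hessPhi_apply (h : RegularTask μ lf0 lf lg lg1 lg2 f g) (θ : Vec p) (φ u : Vec q) :
    (hessPhi g θ φ).inverse (hessPhi g θ φ u) = u :=
  (h.isInvertible_hessPhi θ φ).inverse_apply_eq.2 rfl

theorem hessPhi_linearSolution (h : RegularTask μ lf0 lf lg lg1 lg2 f g) (θ : Vec p) (φ : Vec q) :
    hessPhi g θ φ (linearSolution f g θ φ) = gradPhi f θ φ :=
  h.hessPhi_inverse_apply θ φ _

theorem norm_linearSolution_le (h : RegularTask μ lf0 lf lg lg1 lg2 f g) (θ : Vec p) (φ : Vec q) :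
    ‖linearSolution f g θ φ‖ ≤ lf0 / μ := by
  rw [le_div_iff₀ h.mu_pos, mul_comm]
  refine (h.mul_norm_le_norm_hessPhi θ φ _).trans ?_
  rw [h.hessPhi_linearSolution]
  exact norm_gradPhi_le h.smooth.differentiable_f h.smooth.lipschitz_f θ φ

/-- From H v = b and H' v' = b' one gets H(v − v') = (b − b') − (H − H')v', and H is bounded below
by μ. -/
theorem norm_linearSolution_sub_le (h : RegularTask μ lf0 lf lg lg1 lg2 f g) (θ θ' : Vec p)
    (φ φ' : Vec q) : ‖linearSolution f g θ φ - linearSolution f g θ' φ'‖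
      ≤ (lf + lg2 * (lf0 / μ)) / μ * (‖θ - θ'‖ + ‖φ - φ'‖) := by
  rw [div_mul_eq_mul_div, le_div_iff₀ h.mu_pos, mul_comm]
  refine (h.mul_norm_le_norm_hessPhi θ φ _).trans ?_
  have e : hessPhi g θ φ (linearSolution f g θ φ - linearSolution f g θ' φ')
      = (gradPhi f θ φ - gradPhi f θ' φ')
        - (hessPhi g θ φ - hessPhi g θ' φ') (linearSolution f g θ' φ') := by
    rw [map_sub, h.hessPhi_linearSolution, sub_apply, h.hessPhi_linearSolution]
    abel
  have h1 := norm_gradPhi_sub_le h.smooth.differentiable_f h.smooth.lipschitz_grad_f θ θ' φ φ'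
  have h2 : ‖(hessPhi g θ φ - hessPhi g θ' φ') (linearSolution f g θ' φ')‖
      ≤ lg2 * (‖θ - θ'‖ + ‖φ - φ'‖) * (lf0 / μ) :=
    (ContinuousLinearMap.le_opNorm _ _).trans
      (mul_le_mul (norm_joint_sub_le h.smooth.lipschitz_hess_g θ θ' φ φ')
        (h.norm_linearSolution_le θ' φ') (norm_nonneg _) (by positivity))
  rw [e]
  refine (norm_sub_le _ _).trans ?_
  linarith

/-- The splitting puts the difference of the Jacobians on `v'`, so only this vector must be bounded.
It will be the exact solution, while `v` is a conjugate-gradient iterate without an a priori bound.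
-/
theorem norm_hypergradientAt_sub_le (h : RegularTask μ lf0 lf lg lg1 lg2 f g) (θ θ' : Vec p)
    (φ φ' v v' : Vec q) (hv' : ‖v'‖ ≤ lf0 / μ) :
    ‖hypergradientAt f g θ φ v - hypergradientAt f g θ' φ' v'‖
      ≤ (lf + lg1 * (lf0 / μ)) * (‖θ - θ'‖ + ‖φ - φ'‖) + lg * ‖v - v'‖ := by
  have e : hypergradientAt f g θ φ v - hypergradientAt f g θ' φ' v'
      = (gradTheta f θ φ - gradTheta f θ' φ')
        - ((jacThetaPhi g θ φ - jacThetaPhi g θ' φ') v' + jacThetaPhi g θ φ (v - v')) := by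
    simp only [hypergradientAt, map_sub, sub_apply]
    abel
  have h1 := norm_gradTheta_sub_le h.smooth.differentiable_f h.smooth.lipschitz_grad_f θ θ' φ φ'
  have h2 : ‖(jacThetaPhi g θ φ - jacThetaPhi g θ' φ') v'‖
      ≤ lg1 * (‖θ - θ'‖ + ‖φ - φ'‖) * (lf0 / μ) :=
    (ContinuousLinearMap.le_opNorm _ _).trans
      (mul_le_mul (norm_joint_sub_le h.smooth.lipschitz_jac_g θ θ' φ φ')
        hv' (norm_nonneg _) (by positivity))
  have h3 := (jacThetaPhi g θ φ).le_of_opNorm_le (h.norm_jacThetaPhi_le θ φ) (v - v')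
  rw [e]
  refine (norm_sub_le _ _).trans ?_
  have := norm_add_le ((jacThetaPhi g θ φ - jacThetaPhi g θ' φ') v')
    (jacThetaPhi g θ φ (v - v'))
  linarith

/-- Since φ* is already known to be Lipschitz, differentiability of ∇_φ g at the single point (θ,
φ*(θ)) suffices: expand it along the curve, where it vanishes, and apply H⁻¹ to the remainder. -/
theorem hasFDerivAt_phiStar (h : RegularTask μ lf0 lf lg lg1 lg2 f g) (θ : Vec p) :
    HasFDerivAt (phiStar g) (-((hessPhi g θ (phiStar g θ)).inverse ∘L
      (jacThetaPhi g θ (phiStar g θ)).adjoint)) θ := by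
  set H := hessPhi g θ (phiStar g θ) with hH
  set J := jacThetaPhi g θ (phiStar g θ) with hJ
  set z : Vec p → Pair p q := fun θ' => WithLp.toLp 2 (θ', phiStar g θ') with hz
  have hbd : ∀ θ', ‖z θ' - z θ‖ ≤ (1 + lg / μ) * ‖θ' - θ‖ := fun θ' => by
    have h1 := norm_toLp_sub_le θ' θ (phiStar g θ') (phiStar g θ)
    have h2 := h.norm_phiStar_sub_le θ' θ
    simp only [hz]
    linarith
  have hO : (fun θ' => z θ' - z θ) =O[𝓝 θ] fun θ' => θ' - θ :=
    Asymptotics.IsBigO.of_bound _ (Filter.Eventually.of_forall hbd)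
  have htend : Filter.Tendsto z (𝓝 θ) (𝓝 (z θ)) := by
    rw [tendsto_iff_norm_sub_tendsto_zero]
    refine squeeze_zero (fun _ => norm_nonneg _) hbd ?_
    have : Filter.Tendsto (fun θ' : Vec p => (1 + lg / μ) * ‖θ' - θ‖) (𝓝 θ)
        (𝓝 ((1 + lg / μ) * ‖θ - θ‖)) :=
      Continuous.tendsto (by fun_prop) θ
    simpa using this
  have hD := (h.smooth.differentiable_gradPhi_g (z θ)).hasFDerivAt
  have ho := (hD.isLittleO.comp_tendsto htend).trans_isBigO hO
  have hval : ∀ θ', joint (gradPhi g) (z θ') = 0 := fun θ' => h.gradPhi_phiStar θ'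
  have ho2 : (fun θ' => J.adjoint (θ' - θ) + H (phiStar g θ' - phiStar g θ))
      =o[𝓝 θ] fun θ' => θ' - θ := by
    refine ho.neg_left.congr_left fun θ' => ?_
    simp only [Function.comp_apply, hval, sub_self, zero_sub, neg_neg]
    exact h.fderiv_joint_gradPhi θ (θ' - θ) (phiStar g θ) (phiStar g θ' - phiStar g θ)
  have ho3 := (H.inverse.isBigO_comp _ (𝓝 θ)).trans_isLittleO ho2
  rw [hasFDerivAt_iff_isLittleO]
  refine ho3.congr_left fun θ' => ?_
  rw [map_add, h.inverse_hessPhi_apply]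
  simp
  abel

/-- The hypergradient formula by implicit differentiation. -/
theorem hasGradientAt_comp_phiStar (h : RegularTask μ lf0 lf lg lg1 lg2 f g) (θ : Vec p) :
    HasGradientAt (fun θ' => f θ' (phiStar g θ'))
      (hypergradientAt f g θ (phiStar g θ) (linearSolution f g θ (phiStar g θ))) θ := by
  convert hasGradientAt_comp_curve h.smooth.differentiable_f (h.hasFDerivAt_phiStar θ) using 1
  rw [hypergradientAt, sub_eq_add_neg]
  congr 1
  refine ext_inner_right ℝ fun u => ?_
  rw [ContinuousLinearMap.adjoint_inner_left]
  conv_rhs => rw [← h.hessPhi_linearSolution θ (phiStar g θ), h.hessPhi_symm]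
  simp [h.hessPhi_inverse_apply, ContinuousLinearMap.adjoint_inner_right]

end RegularTask

/-! ### One outer iteration on one task: the tracking error. -/

/-- The gradient of `θ ↦ f θ (φ*(θ))`. -/
def exactHypergradient (f g : Vec p → Vec q → ℝ) (θ : Vec p) : Vec p :=
  hypergradientAt f g θ (phiStar g θ) (linearSolution f g θ (phiStar g θ))

/-- The distance of `φ` and `v` from their targets at `θ`, where `φ` is weighted by `m`. -/
def trackingError (m : ℝ) (f g : Vec p → Vec q → ℝ) (θ : Vec p) (φ v : Vec q) : ℝ :=
  ‖v - linearSolution f g θ (phiStar g θ)‖ + m * ‖φ - phiStar g θ‖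

theorem runTask_evalsPhi (f g : Vec p → Vec q → ℝ) (lamPhi : ℝ) (K N : ℕ) (θ : Vec p)
    (φ v : Vec q) : (runTask f g lamPhi K N θ φ v).evalsPhi = K + N + 3 := by
  have h1 : ∀ (k : ℕ) (s : Vec q × ℕ), ((innerStep g lamPhi θ)^[k] s).2 = s.2 + k := by
    intro k
    induction k with
    | zero => simp
    | succ k ih => intro s; rw [Function.iterate_succ_apply', innerStep, ih]; rfl
  have h2 : ∀ (φ : Vec q) (k : ℕ) (s : CGState q),
      ((cgStep g θ φ)^[k] s).evals = s.evals + k := by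
    intro φ k
    induction k with
    | zero => simp
    | succ k ih => intro s; rw [Function.iterate_succ_apply', cgStep, ih]; rfl
  simp only [runTask, h1, h2, cgStart]
  omega

theorem isCGRun_iterate_cgStep (f g : Vec p → Vec q → ℝ) (θ : Vec p) (φ v : Vec q) :
    IsCGRun (hessPhi g θ φ) (fun k => ((cgStep g θ φ)^[k] (cgStart f g θ φ v)).v)
      (fun k => ((cgStep g θ φ)^[k] (cgStart f g θ φ v)).r)
      (fun k => ((cgStep g θ φ)^[k] (cgStart f g θ φ v)).d) where
  d_zero := rfl
  x_succ k := by rw [Function.iterate_succ_apply']; rfl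
  r_succ k := by rw [Function.iterate_succ_apply']; rfl
  d_succ k := by rw [Function.iterate_succ_apply']; rfl

namespace RegularTask

variable {μ : ℝ} {lf0 lf lg lg1 lg2 : ℝ≥0} {f g : Vec p → Vec q → ℝ}

theorem norm_runTask_phi_sub_le (h : RegularTask μ lf0 lf lg lg1 lg2 f g) {lamPhi : ℝ}
    (hlam : 0 < lamPhi) (hle : lamPhi ≤ 1 / lg) {K : ℕ} (hK : 1 ≤ K) (N : ℕ) (θ : Vec p)
    (φ v : Vec q) : ‖(runTask f g lamPhi K N θ φ v).φ - phiStar g θ‖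
      ≤ (1 - lamPhi * μ) * ‖φ - phiStar g θ‖ := by
  have h0 := h.one_sub_nonneg hlam hle
  have h1 : 1 - lamPhi * μ ≤ 1 := by have := mul_pos hlam h.mu_pos; linarith
  have hstep : ∀ x, ‖x - lamPhi • gradPhi g θ x - phiStar g θ‖
      ≤ (1 - lamPhi * μ) * ‖x - phiStar g θ‖ := fun x => by
    simpa [h.gradPhi_phiStar] using h.norm_gradStep_sub_le hlam hle θ x (phiStar g θ)
  have hit : ∀ k : ℕ, ‖((innerStep g lamPhi θ)^[k] (φ, 0)).1 - phiStar g θ‖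
      ≤ (1 - lamPhi * μ) ^ k * ‖φ - phiStar g θ‖ := by
    intro k
    induction k with
    | zero => simp
    | succ k ih =>
      rw [Function.iterate_succ_apply', pow_succ', mul_assoc]
      exact (hstep _).trans (mul_le_mul_of_nonneg_left ih h0)
  refine (hit K).trans (mul_le_mul_of_nonneg_right ?_ (norm_nonneg _))
  exact pow_le_of_le_one h0 h1 (by omega)

theorem norm_runTask_v_sub_le (h : RegularTask μ lf0 lf lg lg1 lg2 f g) (lamPhi : ℝ) (K : ℕ)
    {N : ℕ} (hN : 4 * √((lg : ℝ) / μ) ≤ N) (θ : Vec p) (φ v : Vec q) :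
    ‖(runTask f g lamPhi K N θ φ v).v
        - linearSolution f g θ (runTask f g lamPhi K N θ φ v).φ‖
      ≤ 1 / 2 * ‖v - linearSolution f g θ (runTask f g lamPhi K N θ φ v).φ‖ := by
  set φ' := (runTask f g lamPhi K N θ φ v).φ
  refine (isCGRun_iterate_cgStep f g θ φ' v).norm_error_le (h.hessPhi_symm θ φ') h.mu_pos
    (h.mul_norm_sq_le_inner_hessPhi θ φ') h.lg_pos (h.inner_hessPhi_le θ φ') ?_ hN
  rw [map_sub, h.hessPhi_linearSolution]
  rfl

theorem norm_exactHypergradient_sub_le (h : RegularTask μ lf0 lf lg lg1 lg2 f g) (θ θ' : Vec p) :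
    ‖exactHypergradient f g θ - exactHypergradient f g θ'‖
      ≤ (lf + lg1 * (lf0 / μ) + lg * ((lf + lg2 * (lf0 / μ)) / μ)) * (1 + lg / μ)
        * ‖θ - θ'‖ := by
  have hμ := h.mu_pos
  have h1 := h.norm_hypergradientAt_sub_le θ θ' (phiStar g θ) (phiStar g θ')
    (linearSolution f g θ (phiStar g θ)) (linearSolution f g θ' (phiStar g θ'))
    (h.norm_linearSolution_le _ _)
  have h2 := h.norm_linearSolution_sub_le θ θ' (phiStar g θ) (phiStar g θ')
  have h3 : ‖θ - θ'‖ + ‖phiStar g θ - phiStar g θ'‖ ≤ (1 + lg / μ) * ‖θ - θ'‖ := by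
    have := h.norm_phiStar_sub_le θ θ'
    linarith
  have h4 := mul_le_mul_of_nonneg_left h2 lg.coe_nonneg
  have h5 := mul_le_mul_of_nonneg_left h3 (by positivity :
    0 ≤ lf + lg1 * (lf0 / μ) + lg * ((lf + lg2 * (lf0 / μ)) / μ))
  refine h1.trans ?_
  linarith

end RegularTask

/-- One outer iteration contracts the tracking error, up to the movement of `θ`, and the tracking
error bounds the error of the hypergradient; all constants are uniform. -/
theorem exists_trackingError_constants {μ : ℝ} (lf0 lf lg lg1 lg2 : ℝ≥0) {lamPhi : ℝ} (hμ : 0 < μ)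
    (hlam : 0 < lamPhi) (hle : lamPhi ≤ 1 / lg) :
    ∃ m r c e : ℝ, 0 ≤ m ∧ 0 ≤ r ∧ r < 1 ∧ 0 ≤ c ∧ 0 ≤ e ∧
      ∀ (p q : ℕ) (f g : Vec p → Vec q → ℝ), RegularTask μ lf0 lf lg lg1 lg2 f g →
      ∀ K N : ℕ, 1 ≤ K → 4 * √((lg : ℝ) / μ) ≤ N → ∀ (θ θ' : Vec p) (φ v : Vec q),
        trackingError m f g θ' (runTask f g lamPhi K N θ φ v).φ (runTask f g lamPhi K N θ φ v).v
            ≤ r * trackingError m f g θ φ v + c * ‖θ' - θ‖ ∧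
        ‖hypergradientAt f g θ (runTask f g lamPhi K N θ φ v).φ
              (runTask f g lamPhi K N θ φ v).v - exactHypergradient f g θ‖
            ≤ e * trackingError m f g θ φ v := by
  have hlμ : 0 < lamPhi * μ := mul_pos hlam hμ
  set D : ℝ := (lf + lg2 * (lf0 / μ)) / μ with hD
  have hD0 : 0 ≤ D := by positivity
  -- The error of v picks up 3/2 · D times the error of φ. With this weight half of the contraction
  -- λ_φ μ of the latter pays for it; the summand 1 makes the tracking error dominate the plain
  -- error of φ.
  set m : ℝ := 3 * D / (lamPhi * μ) + 1 with hm
  have hm1 : 1 ≤ m := by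
    have : 0 ≤ 3 * D / (lamPhi * μ) := by positivity
    linarith
  have hmD : 3 / 2 * D ≤ m * (lamPhi * μ / 2) := by
    have : 3 * D / (lamPhi * μ) * (lamPhi * μ) = 3 * D := div_mul_cancel₀ _ hlμ.ne'
    rw [hm]
    linarith
  set r : ℝ := max (1 / 2) (1 - lamPhi * μ / 2) with hr
  have hr1 : 1 / 2 ≤ r := le_max_left _ _
  have hr2 : 1 - lamPhi * μ / 2 ≤ r := le_max_right _ _
  have hr3 : r < 1 := max_lt (by norm_num) (by linarith)
  refine ⟨m, r, D * (1 + lg / μ) + m * (lg / μ),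
    (lf + lg1 * (lf0 / μ)) + lg * (1 / 2 + 3 / 2 * D), by linarith, by linarith, hr3,
    by positivity, by positivity, ?_⟩
  intro p q f g h K N hK hN θ θ' φ v
  set φ₁ := (runTask f g lamPhi K N θ φ v).φ with hφ₁
  set v₁ := (runTask f g lamPhi K N θ φ v).v with hv₁
  set P := ‖φ - phiStar g θ‖ with hP
  set U := ‖v - linearSolution f g θ (phiStar g θ)‖ with hU
  have hP0 : 0 ≤ P := norm_nonneg _
  have hU0 : 0 ≤ U := norm_nonneg _
  have hφ : ‖φ₁ - phiStar g θ‖ ≤ (1 - lamPhi * μ) * P :=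
    h.norm_runTask_phi_sub_le hlam hle hK N θ φ v
  have hφ' : ‖φ₁ - phiStar g θ‖ ≤ P := hφ.trans (by nlinarith)
  have hsol : ‖linearSolution f g θ φ₁ - linearSolution f g θ (phiStar g θ)‖ ≤ D * P := by
    refine (h.norm_linearSolution_sub_le θ θ φ₁ (phiStar g θ)).trans ?_
    rw [sub_self, norm_zero, zero_add]
    exact mul_le_mul_of_nonneg_left hφ' hD0
  -- Halving is relative to the solution at `φ₁`: moving the target there costs D P before halving,
  -- moving it back costs D P again.
  have hv : ‖v₁ - linearSolution f g θ (phiStar g θ)‖ ≤ 1 / 2 * U + 3 / 2 * D * P := by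
    have h1 := h.norm_runTask_v_sub_le lamPhi K hN θ φ v
    have h2 := norm_sub_le_norm_sub_add_norm_sub v₁ (linearSolution f g θ φ₁)
      (linearSolution f g θ (phiStar g θ))
    have h3 := norm_sub_le_norm_sub_add_norm_sub v (linearSolution f g θ (phiStar g θ))
      (linearSolution f g θ φ₁)
    rw [norm_sub_rev (linearSolution f g θ (phiStar g θ))] at h3
    linarith
  have hE : trackingError m f g θ φ v = U + m * P := rfl
  have hstar := h.norm_phiStar_sub_le θ θ'
  rw [norm_sub_rev θ] at hstar
  have hsol' : ‖linearSolution f g θ (phiStar g θ) - linearSolution f g θ' (phiStar g θ')‖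
      ≤ D * (1 + lg / μ) * ‖θ' - θ‖ := by
    refine (h.norm_linearSolution_sub_le θ θ' _ _).trans ?_
    rw [mul_assoc, norm_sub_rev θ]
    exact mul_le_mul_of_nonneg_left (by linarith) hD0
  rw [hE]
  constructor
  · have h1 := norm_sub_le_norm_sub_add_norm_sub v₁ (linearSolution f g θ (phiStar g θ))
      (linearSolution f g θ' (phiStar g θ'))
    have h2 := norm_sub_le_norm_sub_add_norm_sub φ₁ (phiStar g θ) (phiStar g θ')
    have h3 : m * ‖φ₁ - phiStar g θ'‖
        ≤ m * ((1 - lamPhi * μ) * P + lg / μ * ‖θ' - θ‖) :=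
      mul_le_mul_of_nonneg_left (by linarith) (by linarith)
    have h4 : 1 / 2 * U ≤ r * U := mul_le_mul_of_nonneg_right hr1 hU0
    have h5 : (3 / 2 * D + m * (1 - lamPhi * μ)) * P ≤ (m * r) * P := by
      refine mul_le_mul_of_nonneg_right ?_ hP0
      have := mul_le_mul_of_nonneg_left hr2 (by linarith : 0 ≤ m)
      linarith
    rw [trackingError]
    linarith
  · have h1 := h.norm_hypergradientAt_sub_le θ θ φ₁ (phiStar g θ) v₁
      (linearSolution f g θ (phiStar g θ)) (h.norm_linearSolution_le _ _)
    rw [sub_self, norm_zero, zero_add] at h1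
    refine h1.trans ?_
    have hPE : P ≤ U + m * P := by nlinarith
    have hUE : U ≤ U + m * P := by nlinarith
    have h2 : (lf + lg1 * (lf0 / μ)) * ‖φ₁ - phiStar g θ‖
        ≤ (lf + lg1 * (lf0 / μ)) * (U + m * P) :=
      mul_le_mul_of_nonneg_left (hφ'.trans hPE) (by positivity)
    have h3 : lg * ‖v₁ - linearSolution f g θ (phiStar g θ)‖
        ≤ lg * ((1 / 2 + 3 / 2 * D) * (U + m * P)) := by
      refine mul_le_mul_of_nonneg_left (hv.trans ?_) lg.coe_nonneg
      have := mul_le_mul_of_nonneg_left hPE (by positivity : 0 ≤ 3 / 2 * D)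
      linarith
    linarith

/-! ### Averages over the tasks and evaluation counts. -/

section Mean

variable {n : ℕ} {μ : ℝ} {lf0 lf lg lg1 lg2 : ℝ≥0} {f g : Fin n → Vec p → Vec q → ℝ}

theorem norm_mean_le {E : Type*} [NormedAddCommGroup E] [NormedSpace ℝ E] (hn : 0 < n)
    {x : Fin n → E} {b : ℝ} (hx : ∀ i, ‖x i‖ ≤ b) : ‖(1 / (n : ℝ)) • ∑ i, x i‖ ≤ b := by
  have hn' : (0 : ℝ) < n := Nat.cast_pos.2 hn
  rw [norm_smul, Real.norm_of_nonneg (by positivity), one_div_mul_eq_div, div_le_iff₀ hn']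
  refine (norm_sum_le_of_le _ fun i _ => hx i).trans (le_of_eq ?_)
  simp [mul_comm]

theorem norm_mean_sq_le {E : Type*} [NormedAddCommGroup E] [NormedSpace ℝ E] (hn : 0 < n)
    (x : Fin n → E) : ‖(1 / (n : ℝ)) • ∑ i, x i‖ ^ 2 ≤ (1 / (n : ℝ)) * ∑ i, ‖x i‖ ^ 2 := by
  have hn' : (0 : ℝ) < n := Nat.cast_pos.2 hn
  have h1 : ‖∑ i, x i‖ ^ 2 ≤ n * ∑ i, ‖x i‖ ^ 2 := by
    refine (pow_le_pow_left₀ (norm_nonneg _) (norm_sum_le _ _) 2).trans ?_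
    simpa using sq_sum_le_card_mul_sum_sq (s := Finset.univ) (f := fun i => ‖x i‖)
  rw [norm_smul, mul_pow, Real.norm_of_nonneg (by positivity)]
  calc (1 / (n : ℝ)) ^ 2 * ‖∑ i, x i‖ ^ 2 ≤ (1 / (n : ℝ)) ^ 2 * (n * ∑ i, ‖x i‖ ^ 2) :=
        mul_le_mul_of_nonneg_left h1 (by positivity)
    _ = _ := by field_simp

/-- The gradient of the meta-objective. -/
def meanHypergradient (f g : Fin n → Vec p → Vec q → ℝ) (θ : Vec p) : Vec p :=
  (1 / (n : ℝ)) • ∑ i, exactHypergradient (f i) (g i) θ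

theorem hasGradientAt_metaObjective (h : ∀ i, RegularTask μ lf0 lf lg lg1 lg2 (f i) (g i))
    (θ : Vec p) : HasGradientAt (metaObjective f g) (meanHypergradient f g θ) θ := by
  rw [hasGradientAt_iff_hasFDerivAt]
  refine ((HasFDerivAt.fun_sum fun i (_ : i ∈ Finset.univ) =>
    ((h i).hasGradientAt_comp_phiStar θ).hasFDerivAt).const_mul (1 / (n : ℝ))).congr_fderiv ?_
  simp [meanHypergradient, exactHypergradient]

theorem norm_meanHypergradient_sub_le (hn : 0 < n)
    (h : ∀ i, RegularTask μ lf0 lf lg lg1 lg2 (f i) (g i)) (θ θ' : Vec p) :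
    ‖meanHypergradient f g θ - meanHypergradient f g θ'‖
      ≤ (lf + lg1 * (lf0 / μ) + lg * ((lf + lg2 * (lf0 / μ)) / μ)) * (1 + lg / μ)
        * ‖θ - θ'‖ := by
  rw [meanHypergradient, meanHypergradient, ← smul_sub, ← Finset.sum_sub_distrib]
  exact norm_mean_le hn fun i => (h i).norm_exactHypergradient_sub_le θ θ'

theorem metaRun_evalsPhi (f g : Fin n → Vec p → Vec q → ℝ) (lamPhi lamTheta : ℝ) (K N : ℕ)
    (θ0 : Vec p) (φ0 : Fin n → Vec q) (T : ℕ) :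
    (metaRun f g lamPhi lamTheta K N θ0 φ0 T).evalsPhi = T * (n * (K + N + 3)) := by
  induction T with
  | zero => simp [metaRun]
  | succ T ih =>
    rw [metaRun, Function.iterate_succ_apply', ← metaRun, metaStep]
    simp only [runTask_evalsPhi, ih, Finset.sum_const, Finset.card_univ, Fintype.card_fin,
      smul_eq_mul]
    ring

theorem metaRun_evalsTheta (f g : Fin n → Vec p → Vec q → ℝ) (lamPhi lamTheta : ℝ) (K N : ℕ)
    (θ0 : Vec p) (φ0 : Fin n → Vec q) (T : ℕ) :
    (metaRun f g lamPhi lamTheta K N θ0 φ0 T).evalsTheta = T * (n * 2) := by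
  induction T with
  | zero => simp [metaRun]
  | succ T ih =>
    rw [metaRun, Function.iterate_succ_apply', ← metaRun, metaStep]
    simp only [runTask, ih, Finset.sum_const, Finset.card_univ, Fintype.card_fin, smul_eq_mul]
    ring

end Mean

/-! ### The potential and its decrease. -/

variable {n : ℕ}

/-- The mean over the tasks of the squared tracking errors. -/
def meanTrackingError (m : ℝ) (f g : Fin n → Vec p → Vec q → ℝ) (s : MetaState p q n) : ℝ :=
  (1 / (n : ℝ)) * ∑ i, trackingError m (f i) (g i) s.θ (s.φ i) (s.v i) ^ 2

/-- The potential function of the outer loop. -/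
def potential (m a : ℝ) (f g : Fin n → Vec p → Vec q → ℝ) (s : MetaState p q n) : ℝ :=
  metaObjective f g s.θ + a * meanTrackingError m f g s

theorem meanTrackingError_nonneg (m : ℝ) (f g : Fin n → Vec p → Vec q → ℝ)
    (s : MetaState p q n) : 0 ≤ meanTrackingError m f g s :=
  mul_nonneg (by positivity) (Finset.sum_nonneg fun _ _ => sq_nonneg _)

/-- Convexity of the square for the combination r · E + (1 − r) · (w / (1 − r)). -/
theorem mul_add_sq_le {r E w : ℝ} (hr0 : 0 ≤ r) (hr1 : r < 1) :
    (r * E + w) ^ 2 ≤ r * E ^ 2 + w ^ 2 / (1 - r) := by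
  have h1 : 0 < 1 - r := sub_pos.2 hr1
  have e : r * E ^ 2 + w ^ 2 / (1 - r) - (r * E + w) ^ 2
      = r * (1 - r) * (E - w / (1 - r)) ^ 2 := by
    field_simp
    ring
  have : 0 ≤ r * (1 - r) * (E - w / (1 - r)) ^ 2 := by positivity
  linarith

/-- Inexact gradient descent: the potential decreases along one outer iteration. -/
theorem exists_potential_decrease {μ : ℝ} (lf0 lf lg lg1 lg2 : ℝ≥0) {lamPhi : ℝ} (hμ : 0 < μ)
    (hlam : 0 < lamPhi) (hle : lamPhi ≤ 1 / lg) :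
    ∃ m a lamMax : ℝ, 0 ≤ m ∧ 0 ≤ a ∧ 0 < lamMax ∧
      ∀ (p q n : ℕ), 0 < n → ∀ f g : Fin n → Vec p → Vec q → ℝ,
      (∀ i, RegularTask μ lf0 lf lg lg1 lg2 (f i) (g i)) →
      ∀ lamTheta : ℝ, 0 < lamTheta → lamTheta ≤ lamMax →
      ∀ K N : ℕ, 1 ≤ K → 4 * √((lg : ℝ) / μ) ≤ N → ∀ s : MetaState p q n,
        potential m a f g (metaStep f g lamPhi lamTheta K N s)
          ≤ potential m a f g s - lamTheta / 2 * ‖meanHypergradient f g s.θ‖ ^ 2 := by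
  obtain ⟨m, r, c, e, hm, hr0, hr1, hc, he, hmain⟩ :=
    exists_trackingError_constants lf0 lf lg lg1 lg2 hμ hlam hle
  have hr' : 0 < 1 - r := sub_pos.2 hr1
  set LF : ℝ := (lf + lg1 * (lf0 / μ) + lg * ((lf + lg2 * (lf0 / μ)) / μ)) * (1 + lg / μ) with hLF
  have hLF0 : 0 ≤ LF := by positivity
  -- Chosen so that the contraction gain a(1 − r)M equals e²M/2, which covers the gradient error λ/2
  -- · e²M as soon as λ ≤ 1.
  set a : ℝ := e ^ 2 / (2 * (1 - r)) with ha
  have ha0 : 0 ≤ a := by positivity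
  set b : ℝ := c ^ 2 / (1 - r) with hb
  have hb0 : 0 ≤ b := by positivity
  have hden : 0 < 1 + LF + 2 * a * b := by positivity
  -- The 1 in the denominator gives λ ≤ 1; the rest makes the terms of order λ²‖H‖² at most λ/2 ·
  -- ‖H‖².
  refine ⟨m, a, 1 / (1 + LF + 2 * a * b), hm, ha0, by positivity, ?_⟩
  intro p q n hn f g h lam hlam0 hlamMax K N hK hN s
  have hn' : (0 : ℝ) < n := Nat.cast_pos.2 hn
  set s' := metaStep f g lamPhi lam K N s with hs'
  set H : Vec p := (1 / (n : ℝ)) • ∑ i, hypergradientAt (f i) (g i) s.θ (s'.φ i) (s'.v i) with hH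
  set G := meanHypergradient f g s.θ with hG
  have hθ : s'.θ = s.θ + -(lam • H) := by
    have hsplit : H = (1 / (n : ℝ)) • ∑ i, gradTheta (f i) s.θ (s'.φ i)
        - (1 / (n : ℝ)) • ∑ i, jacThetaPhi (g i) s.θ (s'.φ i) (s'.v i) := by
      simp only [hH, hypergradientAt, Finset.sum_sub_distrib, smul_sub]
    rw [hsplit, ← sub_eq_add_neg]
    rfl
  have hmove : ‖s'.θ - s.θ‖ = lam * ‖H‖ := by
    rw [hθ, add_sub_cancel_left, norm_neg, norm_smul, Real.norm_of_nonneg hlam0.le]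
  have hHG : ‖H - G‖ ^ 2 ≤ e ^ 2 * meanTrackingError m f g s := by
    rw [hH, hG, meanHypergradient, ← smul_sub, ← Finset.sum_sub_distrib]
    refine (norm_mean_sq_le hn _).trans ?_
    rw [meanTrackingError, mul_left_comm, Finset.mul_sum _ _ (e ^ 2)]
    refine mul_le_mul_of_nonneg_left (Finset.sum_le_sum fun i _ => ?_)
      (by positivity : 0 ≤ 1 / (n : ℝ))
    rw [← mul_pow]
    exact pow_le_pow_left₀ (norm_nonneg _)
      (hmain p q (f i) (g i) (h i) K N hK hN s.θ s.θ (s.φ i) (s.v i)).2 2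
  have herr : meanTrackingError m f g s'
      ≤ r * meanTrackingError m f g s + b * (lam * ‖H‖) ^ 2 := by
    have hi : ∀ i, trackingError m (f i) (g i) s'.θ (s'.φ i) (s'.v i) ^ 2
        ≤ r * trackingError m (f i) (g i) s.θ (s.φ i) (s.v i) ^ 2 + b * (lam * ‖H‖) ^ 2 := by
      intro i
      have h1 := (hmain p q (f i) (g i) (h i) K N hK hN s.θ s'.θ (s.φ i) (s.v i)).1
      rw [hmove] at h1
      have h0 : 0 ≤ trackingError m (f i) (g i) s'.θ (s'.φ i) (s'.v i) :=
        add_nonneg (norm_nonneg _) (mul_nonneg hm (norm_nonneg _))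
      refine (pow_le_pow_left₀ h0 h1 2).trans ((mul_add_sq_le hr0 hr1).trans (le_of_eq ?_))
      rw [hb, mul_pow c, div_mul_eq_mul_div]
    rw [meanTrackingError, meanTrackingError, mul_left_comm]
    refine (mul_le_mul_of_nonneg_left (Finset.sum_le_sum fun i _ => hi i)
      (by positivity : 0 ≤ 1 / (n : ℝ))).trans (le_of_eq ?_)
    rw [Finset.sum_add_distrib, ← Finset.mul_sum, Finset.sum_const, Finset.card_univ,
      Fintype.card_fin, nsmul_eq_mul]
    field_simp
  have hdesc : metaObjective f g s'.θ ≤ metaObjective f g s.θ - lam * inner ℝ G H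
      + LF / 2 * (lam * ‖H‖) ^ 2 := by
    have := le_of_lipschitz_gradient (fun θ => hasGradientAt_metaObjective h θ)
      (norm_meanHypergradient_sub_le hn h) s.θ (-(lam • H))
    rw [← hθ, norm_neg, norm_smul, Real.norm_of_nonneg hlam0.le, inner_neg_right,
      inner_smul_right] at this
    linarith
  have hinner : ‖H - G‖ ^ 2 = ‖H‖ ^ 2 - 2 * inner ℝ G H + ‖G‖ ^ 2 := by
    rw [norm_sub_sq_real, real_inner_comm]
  have ha' : a * (1 - r) = e ^ 2 / 2 := by rw [ha]; field_simp
  have hlam1 : lam * (1 + LF + 2 * a * b) ≤ 1 := (le_div_iff₀ hden).1 hlamMax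
  have hlam_le : lam ≤ 1 := by nlinarith [mul_nonneg ha0 hb0]
  have hM := meanTrackingError_nonneg m f g s
  rw [potential, potential]
  set M := meanTrackingError m f g s
  have h1 : a * meanTrackingError m f g s' ≤ a * (r * M + b * (lam * ‖H‖) ^ 2) :=
    mul_le_mul_of_nonneg_left herr ha0
  have h2 : lam / 2 * ‖H - G‖ ^ 2 ≤ a * (1 - r) * M := by
    rw [ha']
    have : lam / 2 * ‖H - G‖ ^ 2 ≤ lam / 2 * (e ^ 2 * M) :=
      mul_le_mul_of_nonneg_left hHG (by positivity)
    have h3 : lam * (e ^ 2 * M) ≤ 1 * (e ^ 2 * M) :=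
      mul_le_mul_of_nonneg_right hlam_le (by positivity)
    linarith
  have h3 : (LF / 2 + a * b) * (lam * ‖H‖) ^ 2 ≤ lam / 2 * ‖H‖ ^ 2 := by
    have h4 : (LF / 2 + a * b) * lam ≤ 1 / 2 := by linarith
    have := mul_le_mul_of_nonneg_right h4 (by positivity : 0 ≤ lam * ‖H‖ ^ 2)
    linarith
  -- Polarisation releases −λ/2 · ‖H‖², which pays for the curvature of F and for the movement of
  -- the targets.
  have h5 : lam * inner ℝ G H = lam / 2 * (‖H‖ ^ 2 + ‖G‖ ^ 2) - lam / 2 * ‖H - G‖ ^ 2 := by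
    rw [hinner]; ring
  linarith

theorem one_le_initialGap {f g : Fin n → Vec p → Vec q → ℝ}
    (hbdd : BddBelow (Set.range (metaObjective f g))) (θ0 : Vec p) (φ0 : Fin n → Vec q) :
    1 ≤ initialGap f g θ0 φ0 := by
  have h1 : 0 ≤ metaObjective f g θ0 - ⨅ θ, metaObjective f g θ := sub_nonneg.2 (ciInf_le hbdd θ0)
  have h2 : 0 ≤ (1 / (n : ℝ)) * ∑ i, ‖φ0 i - phiStar (g i) θ0‖ ^ 2 := by positivity
  rw [initialGap]
  linarith

/-- Starting from v = 0 leaves an error of up to l_{f,0}/μ that no gap or distance controls; the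
summand 1 in Δ₀ absorbs it. -/
theorem potential_zero_sub_iInf_le {μ : ℝ} {lf0 lf lg lg1 lg2 : ℝ≥0} {m a : ℝ} (ha : 0 ≤ a)
    (hn : 0 < n) {f g : Fin n → Vec p → Vec q → ℝ}
    (h : ∀ i, RegularTask μ lf0 lf lg lg1 lg2 (f i) (g i))
    (hbdd : BddBelow (Set.range (metaObjective f g))) (θ0 : Vec p) (φ0 : Fin n → Vec q)
    (k l : ℕ) :
    potential m a f g ⟨θ0, φ0, fun _ => 0, k, l⟩ - ⨅ θ, metaObjective f g θ
      ≤ (1 + a * (2 * (lf0 / μ) ^ 2 + 2 * m ^ 2)) * initialGap f g θ0 φ0 := by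
  have hn' : (0 : ℝ) < n := Nat.cast_pos.2 hn
  have h1 : 0 ≤ metaObjective f g θ0 - ⨅ θ, metaObjective f g θ := sub_nonneg.2 (ciInf_le hbdd θ0)
  set Q : ℝ := (1 / (n : ℝ)) * ∑ i, ‖φ0 i - phiStar (g i) θ0‖ ^ 2 with hQ
  have hQ0 : 0 ≤ Q := by positivity
  have hM : meanTrackingError m f g ⟨θ0, φ0, fun _ => 0, k, l⟩
      ≤ 2 * (lf0 / μ) ^ 2 + 2 * m ^ 2 * Q := by
    have hi : ∀ i, trackingError m (f i) (g i) θ0 (φ0 i) 0 ^ 2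
        ≤ 2 * (lf0 / μ) ^ 2 + 2 * m ^ 2 * ‖φ0 i - phiStar (g i) θ0‖ ^ 2 := by
      intro i
      rw [trackingError, zero_sub, norm_neg]
      have h2 := pow_le_pow_left₀ (norm_nonneg _)
        ((h i).norm_linearSolution_le θ0 (phiStar (g i) θ0)) 2
      nlinarith [sq_nonneg (‖linearSolution (f i) (g i) θ0 (phiStar (g i) θ0)‖
        - m * ‖φ0 i - phiStar (g i) θ0‖)]
    rw [meanTrackingError, hQ]
    refine (mul_le_mul_of_nonneg_left (Finset.sum_le_sum fun i _ => hi i)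
      (by positivity : 0 ≤ 1 / (n : ℝ))).trans (le_of_eq ?_)
    rw [Finset.sum_add_distrib, Finset.sum_const, ← Finset.mul_sum, Finset.card_univ,
      Fintype.card_fin, nsmul_eq_mul]
    field_simp
  have h3 := mul_le_mul_of_nonneg_left hM ha
  have hgap : initialGap f g θ0 φ0
      = 1 + (metaObjective f g θ0 - ⨅ θ, metaObjective f g θ) + Q := rfl
  rw [hgap, potential]
  set δ := metaObjective f g θ0 - ⨅ θ, metaObjective f g θ
  have h4 : 0 ≤ a * (2 * ((lf0 : ℝ) / μ) ^ 2) * (δ + Q) := by positivity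
  have h5 : 0 ≤ a * (2 * m ^ 2) * (1 + δ) := by positivity
  have h6 : metaObjective f g θ0 - ⨅ θ, metaObjective f g θ = δ := rfl
  have h7 : (MetaState.mk θ0 φ0 (fun _ => (0 : Vec q)) k l).θ = θ0 := rfl
  rw [h7]
  linarith

/-- The squared gradients along the outer iterations have bounded sums. -/
theorem exists_sum_norm_gradient_sq_le {μ : ℝ} (lf0 lf lg lg1 lg2 : ℝ≥0) {lamPhi : ℝ} (hμ : 0 < μ)
    (hlam : 0 < lamPhi) (hle : lamPhi ≤ 1 / lg) :
    ∃ lamMax C : ℝ, 0 < lamMax ∧ 0 < C ∧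
      ∀ (p q n : ℕ), 0 < n → ∀ f g : Fin n → Vec p → Vec q → ℝ,
      (∀ i, RegularTask μ lf0 lf lg lg1 lg2 (f i) (g i)) →
      BddBelow (Set.range (metaObjective f g)) →
      ∀ lamTheta : ℝ, 0 < lamTheta → lamTheta ≤ lamMax →
      ∀ K N : ℕ, 1 ≤ K → 4 * √((lg : ℝ) / μ) ≤ N →
      ∀ (θ0 : Vec p) (φ0 : Fin n → Vec q) (T : ℕ),
        ∑ t ∈ Finset.range T, ‖gradient (metaObjective f g)
            (metaRun f g lamPhi lamTheta K N θ0 φ0 t).θ‖ ^ 2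
          ≤ C * initialGap f g θ0 φ0 / lamTheta := by
  obtain ⟨m, a, lamMax, hm, ha, hpos, hmain⟩ :=
    exists_potential_decrease lf0 lf lg lg1 lg2 hμ hlam hle
  refine ⟨lamMax, 2 * (1 + a * (2 * (lf0 / μ) ^ 2 + 2 * m ^ 2)), hpos, by positivity, ?_⟩
  intro p q n hn f g h hbdd lam hlam0 hlamMax K N hK hN θ0 φ0 T
  set s := metaRun f g lamPhi lam K N θ0 φ0 with hs
  have hgrad : ∀ θ, gradient (metaObjective f g) θ = meanHypergradient f g θ := fun θ =>
    (hasGradientAt_metaObjective h θ).gradient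
  simp only [hgrad]
  have hstep : ∀ t, potential m a f g (s (t + 1))
      ≤ potential m a f g (s t) - lam / 2 * ‖meanHypergradient f g (s t).θ‖ ^ 2 := by
    intro t
    have e : s (t + 1) = metaStep f g lamPhi lam K N (s t) := by
      rw [hs, metaRun, Function.iterate_succ_apply']; rfl
    rw [e]
    exact hmain p q n hn f g h lam hlam0 hlamMax K N hK hN (s t)
  have hsum : lam / 2 * ∑ t ∈ Finset.range T, ‖meanHypergradient f g (s t).θ‖ ^ 2
      ≤ potential m a f g (s 0) - potential m a f g (s T) := by
    rw [← Finset.sum_range_sub' (fun t => potential m a f g (s t)) T, Finset.mul_sum]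
    exact Finset.sum_le_sum fun t _ => by linarith [hstep t]
  have hlow : (⨅ θ, metaObjective f g θ) ≤ potential m a f g (s T) := by
    have h1 := ciInf_le hbdd (s T).θ
    have h2 := mul_nonneg ha (meanTrackingError_nonneg m f g (s T))
    rw [potential]
    linarith
  have hzero := potential_zero_sub_iInf_le (m := m) ha hn h hbdd θ0 φ0 0 0
  have e0 : s 0 = ⟨θ0, φ0, fun _ => 0, 0, 0⟩ := rfl
  rw [← e0] at hzero
  rw [le_div_iff₀ hlam0]
  linarith

end MetaLearning

end

/-! ### The rate and the evaluation count. -/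

theorem theorem2 :
    ∃ cK cN cE : ℝ, 0 < cK ∧ 0 < cN ∧ 0 < cE ∧
    ∀ (μ : ℝ) (lf0 lf lg lg1 lg2 : ℝ≥0) (lamPhi : ℝ),
      0 < μ → 0 < lamPhi → lamPhi ≤ 1 / (lg : ℝ) →
    ∃ lamMax C : ℝ, 0 < lamMax ∧ 0 < C ∧
    ∀ (p q n : ℕ), 0 < q → 0 < n →
    ∀ (f g : Fin n → MetaLearning.Vec p → MetaLearning.Vec q → ℝ),
      (∀ i θ, StrongConvexOn Set.univ μ (g i θ)) →
      (∀ i, MetaLearning.TaskSmooth lf0 lf lg lg1 lg2 (f i) (g i)) →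
      BddBelow (Set.range (MetaLearning.metaObjective f g)) →
      Differentiable ℝ (MetaLearning.metaObjective f g) ∧
      ∀ (lamTheta : ℝ), 0 < lamTheta → lamTheta ≤ lamMax →
      ∀ (θ0 : MetaLearning.Vec p) (φ0 : Fin n → MetaLearning.Vec q),
        -- the rate, and convergence of the gradients to zero
        (∀ K N : ℕ, cK * ((lg : ℝ) / μ) ≤ K → cN * √((lg : ℝ) / μ) ≤ N →
          (∀ T : ℕ, 1 ≤ T →
            (1 / ((T : ℝ) + 1)) * ∑ t ∈ Finset.range (T + 1),
                ‖gradient (MetaLearning.metaObjective f g)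
                  (MetaLearning.metaRun f g lamPhi lamTheta K N θ0 φ0 t).θ‖ ^ 2
              ≤ C * MetaLearning.initialGap f g θ0 φ0 / lamTheta / T) ∧
          Filter.Tendsto
            (fun t => gradient (MetaLearning.metaObjective f g)
              (MetaLearning.metaRun f g lamPhi lamTheta K N θ0 φ0 t).θ)
            Filter.atTop (𝓝 0)) ∧
        -- the number of evaluations that reach accuracy `ε`
        (∀ K N : ℕ, K = ⌈cK * ((lg : ℝ) / μ)⌉₊ → N = ⌈cN * √((lg : ℝ) / μ)⌉₊ →
          ∀ ε : ℝ, 0 < ε → ∃ T : ℕ, 1 ≤ T ∧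
            (1 / (T : ℝ)) * ∑ t ∈ Finset.range T,
                ‖gradient (MetaLearning.metaObjective f g)
                  (MetaLearning.metaRun f g lamPhi lamTheta K N θ0 φ0 t).θ‖ ^ 2 ≤ ε ∧
            ((MetaLearning.metaRun f g lamPhi lamTheta K N θ0 φ0 T).evalsPhi : ℝ)
              ≤ cE * n * ((lg : ℝ) / μ) *
                (1 + C * MetaLearning.initialGap f g θ0 φ0 / lamTheta / ε) ∧
            ((MetaLearning.metaRun f g lamPhi lamTheta K N θ0 φ0 T).evalsTheta : ℝ)
              ≤ cE * n * ((lg : ℝ) / μ) *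
                (1 + C * MetaLearning.initialGap f g θ0 φ0 / lamTheta / ε)) := by
  -- Since κ ≥ 1, the choice 1 gives K ≥ 1, and 4 is the conjugate-gradient constant. For the count,
  -- K ≤ 2κ, N ≤ 5κ and the three remaining evaluations are at most 3κ, hence 10.
  refine ⟨1, 4, 10, by norm_num, by norm_num, by norm_num, ?_⟩
  intro μ lf0 lf lg lg1 lg2 lamPhi hμ hlam hle
  obtain ⟨lamMax, C, hlamMax, hC, hmain⟩ :=
    MetaLearning.exists_sum_norm_gradient_sq_le lf0 lf lg lg1 lg2 hμ hlam hle
  refine ⟨lamMax, C, hlamMax, hC, ?_⟩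
  intro p q n hq hn f g hconv hsmooth hbdd
  have h : ∀ i, MetaLearning.RegularTask μ lf0 lf lg lg1 lg2 (f i) (g i) := fun i =>
    ⟨hμ, hq, hconv i, hsmooth i⟩
  have hκ : 1 ≤ (lg : ℝ) / μ := (one_le_div hμ).2 (h ⟨0, hn⟩).mu_le_lg
  refine ⟨fun θ => (MetaLearning.hasGradientAt_metaObjective h θ).differentiableAt, ?_⟩
  intro lamTheta h0 hmax θ0 φ0
  have hgap := MetaLearning.one_le_initialGap hbdd θ0 φ0
  set B := C * MetaLearning.initialGap f g θ0 φ0 / lamTheta with hB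
  have hB0 : 0 < B := by positivity
  constructor
  · intro K N hK hN
    have hK1 : 1 ≤ K := by
      have : (1 : ℝ) ≤ K := by linarith
      exact_mod_cast this
    have hsum := hmain p q n hn f g h hbdd lamTheta h0 hmax K N hK1 hN θ0 φ0
    constructor
    · intro T hT
      have hT0 : (0 : ℝ) < T := by exact_mod_cast hT
      rw [one_div_mul_eq_div]
      exact div_le_div₀ hB0.le (hsum (T + 1)) hT0 (by linarith)
    -- The bound on the partial sums is independent of T, so the squared norms are summable and tend
    -- to zero.
    · have hsummable := summable_of_sum_range_le (fun _ => sq_nonneg _) hsum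
      have hsq := (hsummable.tendsto_atTop_zero).sqrt
      simp only [Real.sqrt_sq (norm_nonneg _), Real.sqrt_zero] at hsq
      exact tendsto_zero_iff_norm_tendsto_zero.2 hsq
  · intro K N hK hN ε hε
    have hKle : (1 : ℝ) * (lg / μ) ≤ K := hK ▸ Nat.le_ceil _
    have hNle : 4 * √((lg : ℝ) / μ) ≤ N := hN ▸ Nat.le_ceil _
    have hK1 : 1 ≤ K := by
      have : (1 : ℝ) ≤ K := by linarith
      exact_mod_cast this
    have hKup : (K : ℝ) ≤ 2 * (lg / μ) := by
      have := Nat.ceil_lt_add_one (by positivity : 0 ≤ 1 * ((lg : ℝ) / μ))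
      rw [← hK] at this
      linarith
    have hNup : (N : ℝ) ≤ 5 * (lg / μ) := by
      have := Nat.ceil_lt_add_one (by positivity : 0 ≤ 4 * √((lg : ℝ) / μ))
      rw [← hN] at this
      have h1 : √((lg : ℝ) / μ) ≤ lg / μ :=
        Real.sqrt_le_iff.2 ⟨by positivity, by nlinarith⟩
      linarith
    have hsum := hmain p q n hn f g h hbdd lamTheta h0 hmax K N hK1 hNle θ0 φ0
    have hBε : 0 < B / ε := by positivity
    have hT1 : 1 ≤ ⌈B / ε⌉₊ := Nat.one_le_iff_ne_zero.2 (Nat.ceil_pos.2 hBε).ne'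
    have hTle : B / ε ≤ ⌈B / ε⌉₊ := Nat.le_ceil _
    have hTup : (⌈B / ε⌉₊ : ℝ) ≤ 1 + B / ε := by
      have := Nat.ceil_lt_add_one hBε.le
      linarith
    -- Averaging the bound B over T ≥ B/ε terms gives at most ε, and rounding up costs the 1 in 1 +
    -- B/ε.
    refine ⟨⌈B / ε⌉₊, hT1, ?_, ?_, ?_⟩
    · have hT0 : (0 : ℝ) < ⌈B / ε⌉₊ := hBε.trans_le hTle
      rw [one_div_mul_eq_div, div_le_iff₀ hT0]
      have := (div_le_iff₀ hε).1 hTle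
      linarith [hsum ⌈B / ε⌉₊]
    · rw [MetaLearning.metaRun_evalsPhi]
      push_cast
      calc (⌈B / ε⌉₊ : ℝ) * (n * (K + N + 3)) ≤ (1 + B / ε) * (n * (10 * (lg / μ))) := by
            refine mul_le_mul hTup ?_ (by positivity) (by positivity)
            exact mul_le_mul_of_nonneg_left (by linarith) (by positivity)
        _ = _ := by ring
    · rw [MetaLearning.metaRun_evalsTheta]
      push_cast
      calc (⌈B / ε⌉₊ : ℝ) * (n * 2) ≤ (1 + B / ε) * (n * (10 * (lg / μ))) := by
            refine mul_le_mul hTup ?_ (by positivity) (by positivity)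
            exact mul_le_mul_of_nonneg_left (by linarith) (by positivity)
        _ = _ := by ring
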